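/- Setting. Let $0<\vartheta<\pi$ and let $k\in C_0^\infty(-1,1)$ be real with $\int_{\mathbb R}k(s)\,ds=1$. For $\delta>0$ let $\Gamma_{\vartheta,\delta}\subset\mathbb R^2$ be the image of a curve, parametrized by arc length $s\in\mathbb R$, with signed curvature $k_\delta(s)=\frac{\vartheta}{\delta}k(s/\delta)$ (this determines it up to a rigid motion), and let $d_\delta(q)=\mathrm{dist}(q,\Gamma_{\vartheta,\delta})$. For $\varepsilon>0$ let $\widehat H(\varepsilon,\delta)=-\frac12\Delta+\frac1{2\varepsilon^2}d_\delta^2$ on $L^2(\mathbb R^2)$ be the operator associated with the closure of the quadratic form $\frac12\|\nabla\varphi\|^2+\frac1{2\varepsilon^2}\|d_\delta\varphi\|^2$ on $C_c^\infty(\mathbb R^2)$, and let $\widehat H_D(\varepsilon,\delta)$ be the same Hamiltonian with Dirichlet boundary conditions on the set $\{d_\delta=\delta\}$, i.e. the operator associated with the closure of the same form on $C_c^\infty(\{d_\delta\neq\delta\})$. $F_A$ denotes multiplication by the characteristic function of the region $A$. Theorem. For all $\varepsilon,\delta>0$, $\widehat H(\varepsilon,\delta)$ and $\widehat H_D(\varepsilon,\delta)$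 generate strongly continuous unitary groups $e^{-it\widehat H(\varepsilon,\delta)}$, $e^{-it\widehat H_D(\varepsilon,\delta)}$, and the following hold. (1) Let $\varepsilon,\delta>0$, $C_1\in\mathbb R$, and let $\psi$ be in the domain of $\widehat H(\varepsilon,\delta)$ with $\|\psi\|=1$ and $\|\widehat H(\varepsilon,\delta)\psi\|\le C_1/\varepsilon$. Then for all $t\in\mathbb R$ $$\|F_{d_\delta\ge\delta}\,e^{-it\widehat H(\varepsilon,\delta)}\psi\|\le(2C_1)^{1/2}\,\frac{\varepsilon^{1/2}}{\delta}.$$ (2) For all $C_1,T$ there is a constant $C_2=C_2(C_1,T)$ such that the following holds. Let $\delta=\delta(\varepsilon)>0$ be a function of $\varepsilon>0$ with $\lim_{\varepsilon\to0}\delta(\varepsilon)=0$ and $\lim_{\varepsilon\to0}\varepsilon^{1/2}/\delta(\varepsilon)=0$. Then for all sufficiently small $\varepsilon>0$ (how small may depend on $\vartheta$, $k$ and the function $\delta(\cdot)$), for every $\psi$ in the domain of $\widehat H(\varepsilon,\delta)$ with $\|\psi\|=1$ and $\|\widehat H(\varepsilon,\delta)\psi\|\le C_1/\varepsilon$, and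 for all $t\in[0,T]$, $$\|F_{d_\delta<\delta}\,e^{-it\widehat H(\varepsilon,\delta)}\psi-e^{-it\widehat H_D(\varepsilon,\delta)}F_{d_\delta<\delta}\psi\|\le C_2\left(\frac{\varepsilon^{1/4}}{\delta^{5/2}}+\frac{\varepsilon^{1/2}}{\delta^{3}}\right),\qquad\delta=\delta(\varepsilon).$$ -/

import Mathlib

open MeasureTheory Filter Topology
open scoped ContDiff InnerProductSpace

noncomputable section

namespace ConstrainedPlane

/-- The Euclidean plane. -/
abbrev Plane : Type := EuclideanSpace ℝ (Fin 2)

/-- The Hilbert space of complex square-integrable functions on the plane. -/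
abbrev L2 : Type := Lp ℂ 2 (volume : Measure Plane)

/-- The Hilbert space of square-integrable fields with values in `ℂ²`. -/
abbrev L2Field : Type := Lp (EuclideanSpace ℂ (Fin 2)) 2 (volume : Measure Plane)

/-! ### Unitary groups -/

/-- `U` is the strongly continuous one-parameter unitary group `t ↦ exp (-i t A)`:
its generator is `-i A`, domains included. -/
structure IsUnitaryGroupOf (A : L2 →ₗ.[ℂ] L2) (U : ℝ → L2 →L[ℂ] L2) : Prop where
  unitary : ∀ t, U t ∈ unitary (L2 →L[ℂ] L2)
  map_zero : U 0 = 1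
  map_add : ∀ s t, U (s + t) = U s * U t
  continuous : ∀ ψ, Continuous fun t => U t ψ
  generator : ∀ ψ η, (ψ, η) ∈ A.graph ↔
    HasDerivAt (fun t => U t ψ) (-(Complex.I • η)) 0

open scoped Classical in
/-- `evolution A t` is `exp (-i t A)`; the value `0` is used only if `-i A` generates no
unitary group. -/
def evolution (A : L2 →ₗ.[ℂ] L2) (t : ℝ) : L2 →L[ℂ] L2 :=
  if h : ∃ U, IsUnitaryGroupOf A U then h.choose t else 0

/-! ### Schrödinger operators with Dirichlet boundary conditions -/

/-- The space `C_c^∞(Ω)` of complex test functions. -/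
def testFunctions (Ω : Set Plane) : Submodule ℂ (Plane → ℂ) where
  carrier := {φ | ContDiff ℝ ∞ φ ∧ HasCompactSupport φ ∧ tsupport φ ⊆ Ω}
  zero_mem' := by
    refine ⟨contDiff_const, HasCompactSupport.zero, ?_⟩
    rw [show tsupport (0 : Plane → ℂ) = ∅ from tsupport_eq_empty_iff.2 rfl]
    exact Set.empty_subset _
  add_mem' := by
    rintro f g ⟨hf, hf', hf''⟩ ⟨hg, hg', hg''⟩
    exact ⟨hf.add hg, hf'.add hg', (tsupport_add f g).trans (Set.union_subset hf'' hg'')⟩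
  smul_mem' := by
    rintro c f ⟨hf, hf', hf''⟩
    refine ⟨contDiff_const.smul hf, hf'.smul_left, ?_⟩
    exact (tsupport_smul_subset_right (fun _ => c) f).trans hf''

/-- The gradient `(∂₁ φ, ∂₂ φ)`. -/
def grad (φ : Plane → ℂ) (q : Plane) : EuclideanSpace ℂ (Fin 2) :=
  WithLp.toLp 2 fun i => fderiv ℝ φ q (EuclideanSpace.single i 1)

theorem memLp_test {Ω : Set Plane} (φ : testFunctions Ω) :
    MemLp (φ : Plane → ℂ) 2 volume :=
  φ.2.1.continuous.memLp_of_hasCompactSupport φ.2.2.1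

theorem memLp_grad {Ω : Set Plane} (φ : testFunctions Ω) :
    MemLp (grad (φ : Plane → ℂ)) 2 volume := by
  have hc : Continuous (fderiv ℝ (φ : Plane → ℂ)) := φ.2.1.continuous_fderiv (by simp)
  refine Continuous.memLp_of_hasCompactSupport ?_ ?_
  · unfold grad
    fun_prop
  · refine (φ.2.2.1.fderiv (𝕜 := ℝ)).mono ?_
    intro q hq
    contrapose! hq
    simp only [Function.mem_support, not_not] at hq ⊢
    ext i
    simp [grad, hq]

theorem memLp_sqrt_mul {Ω : Set Plane} (V : C(Plane, ℝ)) (φ : testFunctions Ω) :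
    MemLp (fun q => (Real.sqrt (V q) : ℂ) * (φ : Plane → ℂ) q) 2 volume := by
  have hc := φ.2.1.continuous
  refine Continuous.memLp_of_hasCompactSupport ?_ (φ.2.2.1.mul_left)
  fun_prop

/-- The map `φ ↦ (φ, ∇φ, √V φ)` on test functions. For `V ≥ 0`, the closure of its range
is the graph of the closed quadratic form `½ ‖∇ψ‖² + ‖√V ψ‖²` on `Ω`, its first projection
is the form domain (`H¹₀(Ω)` intersected with the domain of `√V`). -/
def formMap (Ω : Set Plane) (V : C(Plane, ℝ)) :
    testFunctions Ω →ₗ[ℂ] L2 × L2Field × L2 where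
  toFun φ := ((memLp_test φ).toLp _, (memLp_grad φ).toLp _, (memLp_sqrt_mul V φ).toLp _)
  map_add' φ χ := by
    refine Prod.ext ?_ (Prod.ext ?_ ?_)
    · exact MemLp.toLp_add (memLp_test φ) (memLp_test χ)
    · simp only [Prod.snd_add, Prod.fst_add]
      rw [← MemLp.toLp_add]
      congr 1
      funext q
      ext i
      have h1 : DifferentiableAt ℝ (φ : Plane → ℂ) q := φ.2.1.differentiable (by simp) q
      have h2 : DifferentiableAt ℝ (χ : Plane → ℂ) q := χ.2.1.differentiable (by simp) q
      simp [grad, fderiv_add h1 h2]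
    · simp only [Prod.snd_add]
      rw [← MemLp.toLp_add]
      congr 1
      funext q
      simp [mul_add]
  map_smul' c φ := by
    refine Prod.ext ?_ (Prod.ext ?_ ?_)
    · exact MemLp.toLp_const_smul c (memLp_test φ)
    · simp only [Prod.smul_snd, Prod.smul_fst, RingHom.id_apply]
      rw [← MemLp.toLp_const_smul]
      congr 1
      funext q
      ext i
      have h1 : DifferentiableAt ℝ (φ : Plane → ℂ) q := φ.2.1.differentiable (by simp) q
      simp [grad, fderiv_const_smul h1 c]
    · simp only [Prod.smul_snd, RingHom.id_apply]
      rw [← MemLp.toLp_const_smul]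
      congr 1
      funext q
      simp [mul_left_comm]

/-- The graph of the operator associated with the closed form above: `ψ` is in the form
domain and `½ ⟨∇φ, ∇ψ⟩ + ⟨√V φ, √V ψ⟩ = ⟨φ, η⟩` for all test functions `φ`. -/
def schrodingerGraph (Ω : Set Plane) (V : C(Plane, ℝ)) : Submodule ℂ (L2 × L2) where
  carrier := {p | ∃ (g : L2Field) (w : L2),
    (p.1, g, w) ∈ (LinearMap.range (formMap Ω V)).topologicalClosure ∧
    ∀ φ : testFunctions Ω,
      (1 / 2 : ℂ) * ⟪(formMap Ω V φ).2.1, g⟫_ℂ + ⟪(formMap Ω V φ).2.2, w⟫_ℂ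
        = ⟪(formMap Ω V φ).1, p.2⟫_ℂ}
  zero_mem' := ⟨0, 0, Submodule.zero_mem _, by simp⟩
  add_mem' := by
    rintro p p' ⟨g, w, h, e⟩ ⟨g', w', h', e'⟩
    refine ⟨g + g', w + w', Submodule.add_mem _ h h', fun φ => ?_⟩
    have := congrArg₂ (· + ·) (e φ) (e' φ)
    simp only [Prod.snd_add, inner_add_right] at this ⊢
    rw [← this]
    ring
  smul_mem' := by
    rintro c p ⟨g, w, h, e⟩
    refine ⟨c • g, c • w, Submodule.smul_mem _ c h, fun φ => ?_⟩
    have := congrArg (c * ·) (e φ)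
    simp only [Prod.smul_snd, inner_smul_right] at this ⊢
    rw [← this]
    ring

/-- The self-adjoint operator `-½ Δ + V` on `L²`, with Dirichlet boundary conditions on the
complement of the open set `Ω` (for `V ≥ 0` and `Ω` of full measure). -/
def schrodinger (Ω : Set Plane) (V : C(Plane, ℝ)) : L2 →ₗ.[ℂ] L2 :=
  (schrodingerGraph Ω V).toLinearPMap

/-! ### The constraining Hamiltonians -/

/-- The potential `ε⁻² W`, where `W = ½ dist(·, Γ)²`. -/
def constrainingPotential (ε : ℝ) (Γ : Set Plane) : C(Plane, ℝ) where
  toFun q := 1 / ε ^ 2 * (1 / 2 * Metric.infDist q Γ ^ 2)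
  continuous_toFun := by
    have := Metric.continuous_infDist_pt Γ
    fun_prop

/-- `H(ε) = -½ Δ + ε⁻² W` on the plane. -/
def hamiltonian (ε : ℝ) (Γ : Set Plane) : L2 →ₗ.[ℂ] L2 :=
  schrodinger Set.univ (constrainingPotential ε Γ)

/-- `H(ε)` with Dirichlet boundary conditions on the set `{dist(·, Γ) = δ}`. -/
def dirichletHamiltonian (ε δ : ℝ) (Γ : Set Plane) : L2 →ₗ.[ℂ] L2 :=
  schrodinger {q | Metric.infDist q Γ ≠ δ} (constrainingPotential ε Γ)

/-- Multiplication by the characteristic function of a measurable set. -/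
def cutoff (S : Set Plane) (hS : MeasurableSet S) (ψ : L2) : L2 :=
  ((Lp.memLp ψ).indicator hS).toLp _

/-- `F_{d ≥ δ} ψ`, where `d` is the distance from `Γ`. -/
def outsideTube (δ : ℝ) (Γ : Set Plane) (ψ : L2) : L2 :=
  cutoff {q | δ ≤ Metric.infDist q Γ}
    (isClosed_le continuous_const (Metric.continuous_infDist_pt Γ)).measurableSet ψ

/-- `F_{d < δ} ψ`, where `d` is the distance from `Γ`. -/
def insideTube (δ : ℝ) (Γ : Set Plane) (ψ : L2) : L2 :=
  cutoff {q | Metric.infDist q Γ < δ}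
    (isOpen_lt (Metric.continuous_infDist_pt Γ) continuous_const).measurableSet ψ

/-! ### The smoothed curves -/

/-- `γ` is a curve parametrized by arc length with signed curvature `κ`: the unit tangent `τ`
and the unit normal `n = (-τ₂, τ₁)` satisfy `γ' = τ` and `τ' = κ n`. -/
def HasCurvature (γ : ℝ → Plane) (κ : ℝ → ℝ) : Prop :=
  ∃ τ : ℝ → Plane, (∀ s, HasDerivAt γ (τ s) s) ∧ (∀ s, ‖τ s‖ = 1) ∧
    ∀ s, HasDerivAt τ (κ s • !₂[-(τ s 1), τ s 0]) s

/-- The curvature profile `k`: smooth, supported in `(-1, 1)`, of integral one. -/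
structure IsProfile (k : ℝ → ℝ) : Prop where
  smooth : ContDiff ℝ ∞ k
  support : tsupport k ⊆ Set.Ioo (-1) 1
  integral : ∫ s, k s = 1

/-- `Γ` is a smoothed graph `Γ_{ϑ,δ}`: a curve with curvature `k_δ(s) = (ϑ/δ) k(s/δ)`, which
determines it up to a rigid motion of the plane. -/
def IsSmoothedGraph (ϑ : ℝ) (k : ℝ → ℝ) (δ : ℝ) (Γ : Set Plane) : Prop :=
  ∃ γ : ℝ → Plane, HasCurvature γ (fun s => ϑ / δ * k (s / δ)) ∧ Γ = Set.range γ

end ConstrainedPlane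

end

/-! Write `d` for the distance to `Γ`, `V = d² / (2ε²)`, `U` for the free and `W` for the Dirichlet
evolution.

The operators are given by closed forms. Projecting onto the form graph solves `(1 + lA)ψ = f`
(`exists_weakSolution`), which yields self-adjointness; the unitary groups are then limits of
exponentials of Yosida approximations (`IsNonnegSelfAdjoint.exists_unitaryGroup`). For the Dirichlet
operator the excluded set `{d = δ}` must be null, which follows from its porosity
(`measure_infDist_eq`).

Localization is Chebyshev's inequality plus conservation of energy: `‖√V U t ψ‖² ≤ C / ε` for all
times, and `√V ≥ δ / (√2 ε)` outside the tube.

For the comparison, take a smooth `X` equal to 1 near `Γ` and supported inside the tube, and `F`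
vanishing near `Γ` but equal to 1 where `∇X ≠ 0`. Testing the equation for `ψ` with `F²ψ` gives
`‖Fψ‖ = O(ε/δ²)` and `‖F∇ψ‖ = O(1/δ)` (`IsWeakSolution.cutoff_bounds`). Duhamel's formula in norm
would meet `∇X · ∇ψ`, for which this gives only `O(1/δ²)`. Instead the scalar `⟨W t Xψ, X U t ψ⟩` is
differentiated: in the commutator each term pairs a gradient with a function cut off away from `Γ`,
and the derivative is `O(ε^(1/2)/δ³)` (`norm_inner_commutator_le`, `norm_inner_evolution_sub_le`).
Since `Xψ` and `X U t ψ` have norm at most 1 and `‖Xψ‖` is close to 1, expanding `‖X U t ψ - W t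
Xψ‖²` turns this into a norm bound, at the price of a square root: hence `ε^(1/4)`
(`norm_mul_evolution_sub_sq_le`). Replacing `X` by the sharp cutoff costs `‖Fψ‖`. -/

noncomputable section

namespace ConstrainedPlane

/-! ### Nonnegative self-adjoint relations and their unitary groups -/

section SelfAdjoint

variable {H : Type*} [NormedAddCommGroup H] [InnerProductSpace ℂ H]

/-- `G` is the graph of a nonnegative self-adjoint operator. -/
structure IsNonnegSelfAdjoint (G : Submodule ℂ (H × H)) : Prop where
  snd_eq_zero : ∀ y, ((0 : H), y) ∈ G → y = 0
  symm : ∀ p ∈ G, ∀ q ∈ G, ⟪p.1, q.2⟫_ℂ = ⟪p.2, q.1⟫_ℂ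
  nonneg : ∀ p ∈ G, 0 ≤ (⟪p.1, p.2⟫_ℂ).re
  surj : ∀ l : ℝ, 0 < l → ∀ f, ∃ p ∈ G, p.1 + (l : ℂ) • p.2 = f

/-- `J = (1 + l A)⁻¹`, where `G` is the graph of `A`. -/
def IsResolvent (G : Submodule ℂ (H × H)) (l : ℝ) (J : H →L[ℂ] H) : Prop :=
  ∀ f, (J f, (l : ℂ)⁻¹ • (f - J f)) ∈ G

/-- The Yosida approximation `l⁻¹ (1 - J)`. -/
def yosida (l : ℝ) (J : H →L[ℂ] H) : H →L[ℂ] H := (l : ℂ)⁻¹ • (1 - J)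

theorem yosida_apply (l : ℝ) (J : H →L[ℂ] H) (f : H) :
    yosida l J f = (l : ℂ)⁻¹ • (f - J f) := by
  simp [yosida]

variable {G : Submodule ℂ (H × H)}

/-- Pair `(1 + lA)x` with `x` and drop the nonnegative term. This gives both uniqueness for the
resolvent equation and contractivity of the resolvent. -/
theorem IsNonnegSelfAdjoint.norm_fst_le (hG : IsNonnegSelfAdjoint G) {l : ℝ} (hl : 0 < l)
    {p : H × H} (hp : p ∈ G) : ‖p.1‖ ≤ ‖p.1 + (l : ℂ) • p.2‖ := by
  have h1 : ‖p.1‖ ^ 2 ≤ (⟪p.1, p.1 + (l : ℂ) • p.2⟫_ℂ).re := by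
    rw [inner_add_right, inner_smul_right, Complex.add_re, Complex.re_ofReal_mul]
    have := hG.nonneg p hp
    have h2 : (⟪p.1, p.1⟫_ℂ).re = ‖p.1‖ ^ 2 := inner_self_eq_norm_sq (𝕜 := ℂ) p.1
    rw [h2]
    nlinarith
  have h2 : (⟪p.1, p.1 + (l : ℂ) • p.2⟫_ℂ).re ≤ ‖p.1‖ * ‖p.1 + (l : ℂ) • p.2‖ :=
    re_inner_le_norm (𝕜 := ℂ) _ _
  by_contra! h
  have := norm_nonneg (p.1 + (l : ℂ) • p.2)
  nlinarith [norm_nonneg p.1]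

theorem IsNonnegSelfAdjoint.fst_eq (hG : IsNonnegSelfAdjoint G) {l : ℝ} (hl : 0 < l)
    {p q : H × H} (hp : p ∈ G) (hq : q ∈ G)
    (h : p.1 + (l : ℂ) • p.2 = q.1 + (l : ℂ) • q.2) : p.1 = q.1 := by
  have := hG.norm_fst_le hl (G.sub_mem hp hq)
  have h0 : (p - q).1 + (l : ℂ) • (p - q).2 = 0 := by
    rw [Prod.fst_sub, Prod.snd_sub, smul_sub, sub_add_sub_comm, h, sub_self]
  rw [h0, norm_zero] at this
  exact sub_eq_zero.1 (norm_le_zero_iff.1 this)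

theorem IsNonnegSelfAdjoint.exists_resolvent (hG : IsNonnegSelfAdjoint G) {l : ℝ} (hl : 0 < l) :
    ∃ J : H →L[ℂ] H, IsResolvent G l J := by
  choose p hp hpe using hG.surj l hl
  have hl' : (l : ℂ) ≠ 0 := by exact_mod_cast hl.ne'
  let J : H →ₗ[ℂ] H :=
    { toFun := fun f => (p f).1
      map_add' := fun f g => by
        refine hG.fst_eq hl (hp _) (G.add_mem (hp f) (hp g)) ?_
        rw [hpe, Prod.fst_add, Prod.snd_add, smul_add, add_add_add_comm, hpe, hpe]
      map_smul' := fun c f => by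
        refine hG.fst_eq hl (hp _) (G.smul_mem c (hp f)) ?_
        rw [hpe, Prod.smul_fst, Prod.smul_snd, smul_comm, ← smul_add, hpe] }
  refine ⟨J.mkContinuous 1 fun f => ?_, fun f => ?_⟩
  · have := hG.norm_fst_le hl (hp f)
    rw [hpe] at this
    simpa [J] using this
  · have h : (l : ℂ)⁻¹ • (f - (p f).1) = (p f).2 := by
      nth_rw 1 [← hpe f]
      rw [add_sub_cancel_left, smul_smul, inv_mul_cancel₀ hl', one_smul]
    change ((p f).1, (l : ℂ)⁻¹ • (f - (p f).1)) ∈ G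
    rw [h]
    exact hp f

namespace IsResolvent

variable {l : ℝ} {J : H →L[ℂ] H}

theorem yosida_mem (hJ : IsResolvent G l J) (f : H) : (J f, yosida l J f) ∈ G := by
  rw [yosida_apply]
  exact hJ f

theorem add_yosida (hl : 0 < l) (f : H) : J f + (l : ℂ) • yosida l J f = f := by
  have hl' : (l : ℂ) ≠ 0 := by exact_mod_cast hl.ne'
  rw [yosida_apply, smul_smul, mul_inv_cancel₀ hl', one_smul, add_sub_cancel]

theorem apply_add (hG : IsNonnegSelfAdjoint G) (hl : 0 < l) (hJ : IsResolvent G l J)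
    {p : H × H} (hp : p ∈ G) : J (p.1 + (l : ℂ) • p.2) = p.1 :=
  hG.fst_eq hl (hJ.yosida_mem _) hp (add_yosida hl _)

theorem yosida_eq (hG : IsNonnegSelfAdjoint G) (hl : 0 < l) (hJ : IsResolvent G l J)
    {p : H × H} (hp : p ∈ G) : yosida l J p.1 = J p.2 := by
  have hl' : (l : ℂ) ≠ 0 := by exact_mod_cast hl.ne'
  have h := hJ.apply_add hG hl hp
  rw [map_add, map_smul] at h
  rw [yosida_apply]
  nth_rw 1 [← h]
  rw [add_sub_cancel_left, smul_smul, inv_mul_cancel₀ hl', one_smul]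

theorem norm_apply_le (hG : IsNonnegSelfAdjoint G) (hl : 0 < l) (hJ : IsResolvent G l J)
    (f : H) : ‖J f‖ ≤ ‖f‖ := by
  have := hG.norm_fst_le hl (hJ.yosida_mem f)
  rwa [add_yosida hl] at this

theorem inner_left_eq (hG : IsNonnegSelfAdjoint G) (hl : 0 < l) (hJ : IsResolvent G l J)
    (f g : H) : ⟪J f, g⟫_ℂ = ⟪f, J g⟫_ℂ := by
  have h := hG.symm _ (hJ.yosida_mem f) _ (hJ.yosida_mem g)
  nth_rw 1 [← add_yosida (J := J) hl g]
  nth_rw 2 [← add_yosida (J := J) hl f]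
  simp only at h
  rw [inner_add_right, inner_add_left, inner_smul_left, inner_smul_right, h,
    Complex.conj_ofReal]

theorem commute (hG : IsNonnegSelfAdjoint G) (hl : 0 < l) (hJ : IsResolvent G l J)
    {m : ℝ} (hm : 0 < m) {K : H →L[ℂ] H} (hK : IsResolvent G m K) : Commute J K := by
  have hl' : (l : ℂ) ≠ 0 := by exact_mod_cast hl.ne'
  ext f
  change J (K f) = K (J f)
  have h1 := hK.yosida_mem f
  have h2 := hJ.yosida_mem (K f)
  have e1 := add_yosida (J := K) hm f
  have e2 := add_yosida (J := J) hl (K f)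
  set a := J (K f)
  set y := yosida l J (K f)
  set v := yosida m K f
  -- With `a = J K f`, `y = A a` and `v = A K f`, one has `y = (K f - a) / l`, so `y` is itself in
  -- the domain and `A y = (v - y) / l`. Then `(1 + lA)(a + m y) = f`, that is `J f = (1 + mA) a`,
  -- whence `K J f = a`.
  have h3 : (y, (l : ℂ)⁻¹ • (v - y)) ∈ G := by
    have := G.smul_mem (l : ℂ)⁻¹ (G.sub_mem h1 h2)
    have hy : (l : ℂ)⁻¹ • (K f - a) = y := by
      rw [← e2, add_sub_cancel_left, smul_smul, inv_mul_cancel₀ hl', one_smul]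
    simpa [hy] using this
  have h4 := G.add_mem h2 (G.smul_mem (m : ℂ) h3)
  have h5 := hJ.apply_add hG hl h4
  have h6 := hK.apply_add hG hm h2
  simp only [Prod.fst_add, Prod.smul_fst, Prod.snd_add, Prod.smul_snd] at h5 h6
  have e3 : a + (m : ℂ) • y + (l : ℂ) • (y + (m : ℂ) • (l : ℂ)⁻¹ • (v - y)) = f := by
    rw [smul_add, smul_comm (l : ℂ) (m : ℂ), smul_smul (l : ℂ), mul_inv_cancel₀ hl', one_smul,
      smul_sub]
    rw [← e1, ← e2]
    abel
  rw [e3] at h5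
  rw [h5, h6]

end IsResolvent

/-- A symmetric operator with `1 + A` onto has no larger adjoint: solve `(1 + A)q = x + y`; then `x
- q` is orthogonal to the range of `1 + A`, which is everything. -/
theorem IsNonnegSelfAdjoint.mem_of_symm (hG : IsNonnegSelfAdjoint G) {x y : H}
    (h : ∀ p ∈ G, ⟪p.1, y⟫_ℂ = ⟪p.2, x⟫_ℂ) : (x, y) ∈ G := by
  obtain ⟨q, hq, hqe⟩ := hG.surj 1 one_pos (x + y)
  simp only [Complex.ofReal_one, one_smul] at hqe
  have key : ∀ f : H, ⟪f, x - q.1⟫_ℂ = 0 := by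
    intro f
    obtain ⟨p, hp, rfl⟩ := hG.surj 1 one_pos f
    have e : y = q.1 + q.2 - x := by rw [hqe]; abel
    have h1 := h p hp
    have h2 := hG.symm p hp q hq
    rw [e, inner_sub_right, inner_add_right, h2] at h1
    simp only [Complex.ofReal_one, one_smul, inner_add_left, inner_sub_right]
    linear_combination -h1
  have hx : x = q.1 := sub_eq_zero.1 (inner_self_eq_zero.1 (key _))
  have hy : y = q.2 := by
    rw [hx] at hqe
    exact (add_left_cancel hqe).symm
  rw [hx, hy]
  exact hq

/-- If `z` is orthogonal to the domain, write `z = (1 + A)x` and pair with `x`: nonnegativity forces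
`x = 0`, and single-valuedness then gives `z = 0`. -/
theorem IsNonnegSelfAdjoint.dense [CompleteSpace H] (hG : IsNonnegSelfAdjoint G) :
    Dense {x : H | ∃ y, (x, y) ∈ G} := by
  have : (G.map (LinearMap.fst ℂ H H) : Set H) = {x : H | ∃ y, (x, y) ∈ G} := by
    ext x
    simp
  rw [← this, Submodule.dense_iff_topologicalClosure_eq_top,
    Submodule.topologicalClosure_eq_top_iff, Submodule.eq_bot_iff]
  intro z hz
  obtain ⟨p, hp, hpe⟩ := hG.surj 1 one_pos z
  simp only [Complex.ofReal_one, one_smul] at hpe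
  have h0 : ⟪p.1, z⟫_ℂ = 0 := (Submodule.mem_orthogonal _ _).1 hz p.1 ⟨p, hp, rfl⟩
  have h1 : ‖p.1‖ ^ 2 + (⟪p.1, p.2⟫_ℂ).re = 0 := by
    have h2 : (⟪p.1, p.1⟫_ℂ).re = ‖p.1‖ ^ 2 := inner_self_eq_norm_sq (𝕜 := ℂ) p.1
    rw [← h2, ← Complex.add_re, ← inner_add_right, hpe, h0, Complex.zero_re]
  have h3 : p.1 = 0 := by
    have := hG.nonneg p hp
    have : ‖p.1‖ = 0 := by nlinarith [norm_nonneg p.1]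
    exact norm_eq_zero.1 this
  have h4 : p.2 = 0 := hG.snd_eq_zero _ (by rw [← h3]; exact hp)
  rw [← hpe, h3, h4, add_zero]

end SelfAdjoint

/-! ### Stone's theorem by Yosida approximation. -/

section UnitaryGroup

variable {H : Type*} [NormedAddCommGroup H] [InnerProductSpace ℂ H] {G : Submodule ℂ (H × H)}

theorem tendsto_zero_of_dense {ι : Type*} {L : Filter ι} {T : ι → H →L[ℂ] H} {C : ℝ}
    (hC : ∀ i f, ‖T i f‖ ≤ C * ‖f‖) {D : Set H} (hD : Dense D)
    (h : ∀ x ∈ D, Tendsto (fun i => T i x) L (𝓝 0)) (f : H) :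
    Tendsto (fun i => T i f) L (𝓝 0) := by
  rw [Metric.tendsto_nhds]
  intro e he
  have hC1 : 0 < |C| + 1 := by positivity
  obtain ⟨x, hx, hxf⟩ := hD.exists_dist_lt f (ε := e / 2 / (|C| + 1)) (by positivity)
  filter_upwards [Metric.tendsto_nhds.1 (h x hx) (e / 2) (half_pos he)] with i hi
  rw [dist_zero_right] at hi ⊢
  have h1 : T i f = T i (f - x) + T i x := by rw [← map_add, sub_add_cancel]
  rw [dist_eq_norm, lt_div_iff₀ hC1] at hxf
  calc ‖T i f‖ ≤ ‖T i (f - x)‖ + ‖T i x‖ := by rw [h1]; exact norm_add_le _ _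
    _ ≤ C * ‖f - x‖ + ‖T i x‖ := by gcongr; exact hC _ _
    _ < e := by nlinarith [le_abs_self C, norm_nonneg (f - x)]

theorem IsResolvent.tendsto [CompleteSpace H] (hG : IsNonnegSelfAdjoint G) {l : ℕ → ℝ}
    (hl : ∀ n, 0 < l n) (hl0 : Tendsto l atTop (𝓝 0)) {J : ℕ → H →L[ℂ] H}
    (hJ : ∀ n, IsResolvent G (l n) (J n)) (f : H) : Tendsto (fun n => J n f) atTop (𝓝 f) := by
  rw [tendsto_iff_norm_sub_tendsto_zero, ← tendsto_zero_iff_norm_tendsto_zero]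
  refine tendsto_zero_of_dense (T := fun n => J n - 1) (C := 2) (fun n f => ?_) hG.dense ?_ f
  · have := (hJ n).norm_apply_le hG (hl n) f
    calc ‖J n f - f‖ ≤ ‖J n f‖ + ‖f‖ := norm_sub_le _ _
      _ ≤ 2 * ‖f‖ := by linarith
  · rintro x ⟨y, hxy⟩
    have h1 : ∀ n, ‖(J n - 1) x‖ ≤ l n * ‖y‖ := by
      intro n
      have h2 := (hJ n).norm_apply_le hG (hl n) y
      rw [← (hJ n).yosida_eq hG (hl n) hxy] at h2
      have h3 := IsResolvent.add_yosida (J := J n) (hl n) x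
      have h4 : (J n - 1) x = -((l n : ℂ) • yosida (l n) (J n) x) := by
        change J n x - x = _
        nth_rw 2 [← h3]
        abel
      rw [h4, norm_neg, norm_smul, Complex.norm_real, Real.norm_of_nonneg (hl n).le]
      exact mul_le_mul_of_nonneg_left h2 (hl n).le
    refine squeeze_zero_norm h1 ?_
    simpa using hl0.mul_const ‖y‖

theorem IsResolvent.commute_yosida (hG : IsNonnegSelfAdjoint G) {l : ℝ} (hl : 0 < l)
    {J : H →L[ℂ] H} (hJ : IsResolvent G l J) {m : ℝ} (hm : 0 < m) {K : H →L[ℂ] H}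
    (hK : IsResolvent G m K) : Commute (yosida l J) (yosida m K) := by
  have h := hJ.commute hG hl hm hK
  exact ((((Commute.one_left _).sub_left
    ((Commute.one_right J).sub_right h))).smul_left _).smul_right _

variable [CompleteSpace H]

/-- The unitary group `exp (-i t B)` of a bounded operator. -/
def expGroup (B : H →L[ℂ] H) (t : ℝ) : H →L[ℂ] H :=
  NormedSpace.exp (t • (-(Complex.I • B)))

theorem expGroup_zero (B : H →L[ℂ] H) : expGroup B 0 = 1 := by
  let _ := NormedAlgebra.restrictScalars ℚ ℂ (H →L[ℂ] H)
  simp [expGroup]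

theorem expGroup_add (B : H →L[ℂ] H) (s t : ℝ) :
    expGroup B (s + t) = expGroup B s * expGroup B t := by
  let _ := NormedAlgebra.restrictScalars ℚ ℂ (H →L[ℂ] H)
  rw [expGroup, add_smul]
  exact NormedSpace.exp_add_of_commute (((Commute.refl _).smul_left s).smul_right t)

theorem expGroup_mem_unitary {B : H →L[ℂ] H} (hB : IsSelfAdjoint B) (t : ℝ) :
    expGroup B t ∈ unitary (H →L[ℂ] H) := by
  let _ := NormedAlgebra.restrictScalars ℚ ℂ (H →L[ℂ] H)
  refine NormedSpace.exp_mem_unitary_of_mem_skewAdjoint ?_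
  rw [skewAdjoint.mem_iff, star_smul, star_neg, star_smul, hB.star_eq]
  simp

theorem norm_expGroup_apply {B : H →L[ℂ] H} (hB : IsSelfAdjoint B) (t : ℝ) (f : H) :
    ‖expGroup B t f‖ = ‖f‖ :=
  (ContinuousLinearMap.norm_map_iff_adjoint_comp_self _).2
    (Unitary.mem_iff.1 (expGroup_mem_unitary hB t)).1 f

theorem hasDerivAt_expGroup (B : H →L[ℂ] H) (f : H) (t : ℝ) :
    HasDerivAt (fun s => expGroup B s f) (expGroup B t (-(Complex.I • B f))) t := by
  have h := hasDerivAt_exp_smul_const (𝕂 := ℝ) (-(Complex.I • B)) t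
  have h2 := (ContinuousLinearMap.apply ℂ H f).restrictScalars ℝ |>.hasFDerivAt.comp_hasDerivAt t h
  exact h2

theorem norm_expGroup_sub_le {B : H →L[ℂ] H} (hB : IsSelfAdjoint B) (f : H) (t : ℝ) :
    ‖expGroup B t f - f‖ ≤ |t| * ‖B f‖ := by
  have := convex_univ.norm_image_sub_le_of_norm_hasDerivWithin_le (C := ‖B f‖)
    (fun s _ => (hasDerivAt_expGroup B f s).hasDerivWithinAt) (fun s _ => by
      rw [norm_expGroup_apply hB, norm_neg, norm_smul, Complex.norm_I, one_mul])
    (Set.mem_univ (0 : ℝ)) (Set.mem_univ t)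
  simpa [expGroup_zero, mul_comm] using this

/-- Commuting generators factor as `exp(-itB) = exp(-itB') exp(-it(B - B'))`, and the first factor
is an isometry. -/
theorem norm_expGroup_sub_expGroup_le {B B' : H →L[ℂ] H} (hB : IsSelfAdjoint B)
    (hB' : IsSelfAdjoint B') (hc : Commute B B') (f : H) (t : ℝ) :
    ‖expGroup B t f - expGroup B' t f‖ ≤ |t| * ‖B f - B' f‖ := by
  have h : expGroup B t = expGroup B' t * expGroup (B - B') t := by
    have : t • (-(Complex.I • B)) = t • (-(Complex.I • B')) + t • (-(Complex.I • (B - B'))) := by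
      rw [← smul_add, smul_sub]
      congr 1
      abel
    let _ := NormedAlgebra.restrictScalars ℚ ℂ (H →L[ℂ] H)
    rw [expGroup, this]
    refine NormedSpace.exp_add_of_commute (Commute.smul_left (Commute.smul_right ?_ _) _)
    refine Commute.neg_left (Commute.neg_right ?_)
    exact (((hc.symm.sub_right (Commute.refl _))).smul_left _).smul_right _
  rw [h, mul_apply_eq_comp, ← map_sub, norm_expGroup_apply hB']
  exact norm_expGroup_sub_le (hB.sub hB') f t

/-- A first-order expansion that survives the Yosida limit. There `B f` tends to `g = A f`, but `B
g` need not stay bounded, so `g` is replaced by a nearby `h` in the domain, for which `B h`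
converges. -/
theorem norm_expGroup_taylor_le {B : H →L[ℂ] H} (hB : IsSelfAdjoint B) (f g h : H) (t : ℝ) :
    ‖expGroup B t f - f - t • (-(Complex.I • g))‖
      ≤ |t| * (‖B f - g‖ + (2 * ‖g - h‖ + |t| * ‖B h‖)) := by
  have hd : ∀ s, HasDerivAt (fun s : ℝ => expGroup B s f - s • (-(Complex.I • g)))
      (expGroup B s (-(Complex.I • B f)) - (1 : ℝ) • (-(Complex.I • g))) s := fun s =>
    (hasDerivAt_expGroup B f s).sub ((hasDerivAt_id s).smul_const _)
  have hb : ∀ s ∈ Metric.closedBall (0 : ℝ) |t|,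
      ‖expGroup B s (-(Complex.I • B f)) - (1 : ℝ) • (-(Complex.I • g))‖
        ≤ ‖B f - g‖ + (2 * ‖g - h‖ + |t| * ‖B h‖) := by
    intro s hs
    rw [mem_closedBall_zero_iff, Real.norm_eq_abs] at hs
    have e1 : expGroup B s (-(Complex.I • B f)) - (1 : ℝ) • (-(Complex.I • g))
        = -(Complex.I • (expGroup B s (B f - g)
          + (expGroup B s (g - h) + (expGroup B s h - h) - (g - h)))) := by
      simp only [map_neg, map_smul, map_sub, one_smul, smul_add, smul_sub]
      abel
    rw [e1, norm_neg, norm_smul, Complex.norm_I, one_mul]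
    calc _ ≤ ‖expGroup B s (B f - g)‖
          + (‖expGroup B s (g - h)‖ + ‖expGroup B s h - h‖ + ‖g - h‖) :=
          (norm_add_le _ _).trans (add_le_add_right ((norm_sub_le _ _).trans
            (add_le_add_left (norm_add_le _ _) _)) _)
      _ ≤ ‖B f - g‖ + (‖g - h‖ + |t| * ‖B h‖ + ‖g - h‖) := by
          rw [norm_expGroup_apply hB, norm_expGroup_apply hB]
          gcongr
          exact (norm_expGroup_sub_le hB h s).trans (by gcongr)
      _ = _ := by ring
  have := (convex_closedBall (0 : ℝ) |t|).norm_image_sub_le_of_norm_hasDerivWithin_le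
    (fun s _ => (hd s).hasDerivWithinAt) hb (x := 0) (y := t) (by simp) (by simp)
  simp only [expGroup_zero, zero_smul, sub_zero, Real.norm_eq_abs,
    one_apply_eq_self] at this
  rw [sub_right_comm, mul_comm]
  exact this

theorem IsResolvent.isSelfAdjoint_yosida (hG : IsNonnegSelfAdjoint G) {l : ℝ} (hl : 0 < l)
    {J : H →L[ℂ] H} (hJ : IsResolvent G l J) : IsSelfAdjoint (yosida l J) := by
  have h : IsSelfAdjoint J :=
    ContinuousLinearMap.isSelfAdjoint_iff_isSymmetric.2 fun f g => hJ.inner_left_eq hG hl f g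
  rw [yosida, IsSelfAdjoint, star_smul, star_sub, star_one, h.star_eq]
  simp

/-- **Stone's theorem**, for nonnegative operators: a nonnegative self-adjoint operator
generates a strongly continuous unitary group. -/
theorem IsNonnegSelfAdjoint.exists_unitaryGroup (hG : IsNonnegSelfAdjoint G) :
    ∃ U : ℝ → H →L[ℂ] H, (∀ t, U t ∈ unitary (H →L[ℂ] H)) ∧ U 0 = 1 ∧
      (∀ s t, U (s + t) = U s * U t) ∧ (∀ f, Continuous fun t => U t f) ∧
      ∀ f g, (f, g) ∈ G ↔ HasDerivAt (fun t => U t f) (-(Complex.I • g)) 0 := by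
  let l : ℕ → ℝ := fun n => 1 / ((n : ℝ) + 1)
  have hl : ∀ n, 0 < l n := fun n => by positivity
  have hl0 : Tendsto l atTop (𝓝 0) := tendsto_one_div_add_atTop_nhds_zero_nat
  choose J hJ using fun n => hG.exists_resolvent (hl n)
  let B : ℕ → H →L[ℂ] H := fun n => yosida (l n) (J n)
  have hB : ∀ n, IsSelfAdjoint (B n) := fun n => (hJ n).isSelfAdjoint_yosida hG (hl n)
  have hBc : ∀ m n, Commute (B m) (B n) := fun m n =>
    (hJ m).commute_yosida hG (hl m) (hl n) (hJ n)
  have hBt : ∀ f g, (f, g) ∈ G → Tendsto (fun n => B n f) atTop (𝓝 g) := by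
    intro f g hfg
    refine (IsResolvent.tendsto hG hl hl0 hJ g).congr fun n => ?_
    exact ((hJ n).yosida_eq hG (hl n) hfg).symm
  have hcauchy : ∀ t f, CauchySeq fun n => expGroup (B n) t f := by
    intro t f
    rw [cauchySeq_iff_tendsto_dist_atTop_0]
    simp only [dist_eq_norm]
    rw [← tendsto_zero_iff_norm_tendsto_zero]
    refine tendsto_zero_of_dense (C := 2)
      (T := fun p : ℕ × ℕ => expGroup (B p.1) t - expGroup (B p.2) t)
      (fun p f => ?_) hG.dense ?_ f
    · refine (norm_sub_le (expGroup (B p.1) t f) (expGroup (B p.2) t f)).trans ?_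
      rw [norm_expGroup_apply (hB _), norm_expGroup_apply (hB _)]
      linarith
    · rintro x ⟨y, hxy⟩
      refine squeeze_zero_norm (fun p =>
        norm_expGroup_sub_expGroup_le (hB p.1) (hB p.2) (hBc _ _) x t) ?_
      have := (cauchySeq_iff_tendsto_dist_atTop_0.1 (hBt x y hxy).cauchySeq).const_mul |t|
      simpa [dist_eq_norm] using this
  choose V hV using fun t f => cauchySeq_tendsto_of_complete (hcauchy t f)
  have hVn : ∀ t f, ‖V t f‖ = ‖f‖ := fun t f =>
    tendsto_nhds_unique (hV t f).norm (by
      simp only [norm_expGroup_apply (hB _)]; exact tendsto_const_nhds)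
  let W : ℝ → H →ₗ[ℂ] H := fun t =>
    { toFun := V t
      map_add' := fun f g => tendsto_nhds_unique (hV t (f + g))
        (((hV t f).add (hV t g)).congr fun n => (map_add _ _ _).symm)
      map_smul' := fun c f => tendsto_nhds_unique (hV t (c • f))
        (((hV t f).const_smul c).congr fun n => (map_smul _ _ _).symm) }
  let U : ℝ → H →L[ℂ] H := fun t => (W t).mkContinuous 1 fun f => by
    rw [one_mul]
    exact (hVn t f).le
  have hU : ∀ t f, Tendsto (fun n => expGroup (B n) t f) atTop (𝓝 (U t f)) := hV
  have hUn : ∀ t f, ‖U t f‖ = ‖f‖ := hVn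
  have hU0 : U 0 = 1 := by
    ext f
    refine tendsto_nhds_unique (hU 0 f) ?_
    simp only [expGroup_zero]
    exact tendsto_const_nhds
  have hUa : ∀ s t, U (s + t) = U s * U t := by
    intro s t
    ext f
    refine tendsto_nhds_unique (hU (s + t) f) ?_
    have h1 := hU s (U t f)
    have h2 : Tendsto (fun n => expGroup (B n) s (expGroup (B n) t f - U t f)) atTop (𝓝 0) := by
      rw [tendsto_zero_iff_norm_tendsto_zero]
      simp only [norm_expGroup_apply (hB _)]
      exact tendsto_iff_norm_sub_tendsto_zero.1 (hU t f)
    have h3 := h2.add h1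
    rw [zero_add] at h3
    refine h3.congr fun n => ?_
    rw [← map_add, sub_add_cancel, expGroup_add]
    rfl
  have hUu : ∀ t, U t ∈ unitary (H →L[ℂ] H) := by
    intro t
    have h1 : star (U t) * U t = 1 :=
      (ContinuousLinearMap.norm_map_iff_adjoint_comp_self _).1 (hUn t)
    have h2 : U t * U (-t) = 1 := by rw [← hUa, add_neg_cancel, hU0]
    have h3 : star (U t) = U (-t) := by
      rw [← mul_one (star (U t)), ← h2, ← mul_assoc, h1, one_mul]
    exact Unitary.mem_iff.2 ⟨h1, by rw [h3, h2]⟩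
  have hUd : ∀ f g, (f, g) ∈ G → HasDerivAt (fun t => U t f) (-(Complex.I • g)) 0 := by
    intro f g hfg
    have key : ∀ h k, (h, k) ∈ G → ∀ t, ‖U t f - f - t • (-(Complex.I • g))‖
        ≤ |t| * (2 * ‖g - h‖ + |t| * ‖k‖) := by
      intro h k hhk t
      have h1 := (((hU t f).sub_const f).sub_const (t • (-(Complex.I • g)))).norm
      have h2 := (((((hBt f g hfg).sub_const g).norm).add
        ((((hBt h k hhk).norm).const_mul |t|).const_add (2 * ‖g - h‖))).const_mul |t|)
      have := le_of_tendsto_of_tendsto' h1 h2 fun n => norm_expGroup_taylor_le (hB n) f g h t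
      simpa using this
    rw [hasDerivAt_iff_isLittleO, Asymptotics.isLittleO_iff]
    intro c hc
    obtain ⟨h, ⟨k, hhk⟩, hd⟩ := hG.dense.exists_dist_lt g (ε := c / 4) (by positivity)
    rw [dist_eq_norm] at hd
    have hk : 0 < ‖k‖ + 1 := by positivity
    filter_upwards [Metric.ball_mem_nhds (0 : ℝ) (show 0 < c / 2 / (‖k‖ + 1) by positivity)]
      with t ht
    rw [mem_ball_zero_iff, Real.norm_eq_abs, lt_div_iff₀ hk] at ht
    have := key h k hhk t
    simp only [sub_zero, hU0, one_apply_eq_self]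
    refine this.trans ?_
    rw [Real.norm_eq_abs, mul_comm]
    gcongr
    nlinarith [abs_nonneg t]
  have hUc0 : ∀ f, Tendsto (fun t => U t f) (𝓝 0) (𝓝 f) := by
    intro f
    rw [tendsto_iff_norm_sub_tendsto_zero, ← tendsto_zero_iff_norm_tendsto_zero]
    refine tendsto_zero_of_dense (T := fun t => U t - 1) (C := 2) (fun t f => ?_) hG.dense ?_ f
    · refine (norm_sub_le (U t f) f).trans ?_
      rw [hUn]
      linarith
    · rintro x ⟨y, hxy⟩
      have h1 := (hUd x y hxy).continuousAt.tendsto.sub_const x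
      simpa [hU0] using h1
  refine ⟨U, hUu, hU0, hUa, fun f => continuous_iff_continuousAt.2 fun t => ?_,
    fun f g => ⟨hUd f g, fun hd => hG.mem_of_symm fun p hp => ?_⟩⟩
  · have h1 : Tendsto (fun s => U (s - t) f) (𝓝 t) (𝓝 f) := by
      refine (hUc0 f).comp ?_
      have : Tendsto (fun s : ℝ => s - t) (𝓝 t) (𝓝 (t - t)) := tendsto_id.sub_const t
      rwa [sub_self] at this
    have h2 := ((U t).continuous.tendsto f).comp h1
    refine h2.congr fun s => ?_
    change (U t * U (s - t)) f = _
    rw [← hUa, add_sub_cancel]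
  -- The group has no more generator than `G`: differentiating the constant `⟪U t p.1, U t f⟫` at
  -- `0` shows that `(f, g)` lies in the adjoint of `G`, hence in `G` by `mem_of_symm`.
  · have h1 := (hUd p.1 p.2 hp).inner ℂ hd
    have h2 : (fun t => ⟪U t p.1, U t f⟫_ℂ) = fun _ => ⟪p.1, f⟫_ℂ := by
      funext t
      rw [← ContinuousLinearMap.adjoint_inner_right]
      congr 1
      have := (Unitary.mem_iff.1 (hUu t)).1
      exact DFunLike.congr_fun this f
    rw [h2] at h1
    have h3 := h1.unique (hasDerivAt_const (0 : ℝ) ⟪p.1, f⟫_ℂ)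
    simp only [hU0, one_apply_eq_self, inner_neg_right, inner_neg_left,
      inner_smul_right, inner_smul_left, Complex.conj_I] at h3
    have h4 : Complex.I * (⟪p.1, g⟫_ℂ - ⟪p.2, f⟫_ℂ) = 0 := by linear_combination -h3
    have h5 := (mul_eq_zero.1 h4).resolve_left Complex.I_ne_zero
    exact sub_eq_zero.1 h5

end UnitaryGroup

section

/-! ### The Schrödinger operators are self-adjoint -/

/-- The graph `{(ψ, ∇ψ, √V ψ)}` of the closed quadratic form. -/
def formDomain (Ω : Set Plane) (V : C(Plane, ℝ)) : Submodule ℂ (L2 × L2Field × L2) :=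
  (LinearMap.range (formMap Ω V)).topologicalClosure

variable {Ω : Set Plane} {V : C(Plane, ℝ)}

theorem formMap_mem_formDomain (φ : testFunctions Ω) : formMap Ω V φ ∈ formDomain Ω V :=
  Submodule.le_topologicalClosure _ ⟨φ, rfl⟩

theorem formDomain_induction {P : L2 × L2Field × L2 → Prop} (hP : IsClosed {p | P p})
    (h : ∀ φ, P (formMap Ω V φ)) {p : L2 × L2Field × L2} (hp : p ∈ formDomain Ω V) : P p :=
  closure_minimal (s := (LinearMap.range (formMap Ω V) : Set (L2 × L2Field × L2)))
    (by rintro _ ⟨φ, rfl⟩; exact h φ) hP hp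

/-- `p = (ψ, ∇ψ, √V ψ)` with `ψ` in the domain of the Schrödinger operator, which maps it
to `η`. -/
def IsWeakSolution (Ω : Set Plane) (V : C(Plane, ℝ)) (p : L2 × L2Field × L2) (η : L2) : Prop :=
  p ∈ formDomain Ω V ∧ ∀ k ∈ formDomain Ω V,
    (1 / 2 : ℂ) * ⟪k.2.1, p.2.1⟫_ℂ + ⟪k.2.2, p.2.2⟫_ℂ = ⟪k.1, η⟫_ℂ

theorem mem_schrodingerGraph_iff {ψ η : L2} :
    (ψ, η) ∈ schrodingerGraph Ω V ↔ ∃ g w, IsWeakSolution Ω V (ψ, g, w) η := by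
  constructor
  · rintro ⟨g, w, h, e⟩
    refine ⟨g, w, h, fun k hk => ?_⟩
    refine formDomain_induction (P := fun k => (1 / 2 : ℂ) * ⟪k.2.1, g⟫_ℂ + ⟪k.2.2, w⟫_ℂ
      = ⟪k.1, η⟫_ℂ) (isClosed_eq (by fun_prop) (by fun_prop)) e hk
  · rintro ⟨g, w, h, e⟩
    exact ⟨g, w, h, fun φ => e _ (formMap_mem_formDomain φ)⟩

theorem IsWeakSolution.energy {p : L2 × L2Field × L2} {η : L2} (h : IsWeakSolution Ω V p η) :
    (⟪p.1, η⟫_ℂ).re = 1 / 2 * ‖p.2.1‖ ^ 2 + ‖p.2.2‖ ^ 2 := by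
  have h1 : (⟪p.2.1, p.2.1⟫_ℂ).re = ‖p.2.1‖ ^ 2 := inner_self_eq_norm_sq (𝕜 := ℂ) _
  have h2 : (⟪p.2.2, p.2.2⟫_ℂ).re = ‖p.2.2‖ ^ 2 := inner_self_eq_norm_sq (𝕜 := ℂ) _
  have h3 : (1 / 2 : ℂ) = ((1 / 2 : ℝ) : ℂ) := by simp
  rw [← h.2 p h.1, Complex.add_re, h3, Complex.re_ofReal_mul, h1, h2]

theorem eq_zero_of_inner_test (hΩ : IsOpen Ω) (hΩ' : volume Ωᶜ = 0) {η : L2}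
    (h : ∀ φ : testFunctions Ω, ⟪(formMap Ω V φ).1, η⟫_ℂ = 0) : η = 0 := by
  have hη : LocallyIntegrable (η : Plane → ℂ) volume :=
    (Lp.memLp η).locallyIntegrable (by norm_num)
  have h1 : ∀ᵐ x ∂(volume : Measure Plane), x ∈ Ω → η x = 0 := by
    refine hΩ.ae_eq_zero_of_integral_contDiff_smul_eq_zero (hη.locallyIntegrableOn _) ?_
    intro g hg hgc hgs
    let φ : testFunctions Ω := ⟨fun x => (g x : ℂ), Complex.ofRealCLM.contDiff.comp hg,
      hgc.comp_left (g := fun x : ℝ => (x : ℂ)) Complex.ofReal_zero,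
      (tsupport_comp_subset (g := fun x : ℝ => (x : ℂ)) Complex.ofReal_zero g).trans hgs⟩
    rw [← h φ, L2.inner_def]
    refine integral_congr_ae ?_
    have : ((formMap Ω V φ).1 : Plane → ℂ) =ᵐ[volume] fun x => (g x : ℂ) :=
      (memLp_test φ).coeFn_toLp
    filter_upwards [this] with x hx
    rw [hx]
    simp [mul_comm]
  rw [Lp.eq_zero_iff_ae_eq_zero]
  have h2 : ∀ᵐ x ∂(volume : Measure Plane), x ∈ Ω := by
    rw [ae_iff]
    exact hΩ'
  filter_upwards [h1, h2] with x hx hx'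
  exact hx hx'

/-- Lax–Milgram by projection. Scale the coordinates so that the Hilbert norm on the form graph is
`‖ψ‖² + l (½ ‖∇ψ‖² + ‖√V ψ‖²)`; orthogonality of `(f, 0)` minus its projection to the graph is the
weak equation. The map `S` undoes the scaling. -/
theorem exists_weakSolution (l : ℝ) (hl : 0 < l) (f : L2) :
    ∃ p η, IsWeakSolution Ω V p η ∧ p.1 + (l : ℂ) • η = f := by
  let E := WithLp 2 (L2 × WithLp 2 (L2Field × L2))
  let a : ℂ := (Real.sqrt (l / 2) : ℂ)
  let b : ℂ := (Real.sqrt l : ℂ)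
  have ha : a ≠ 0 := by simp only [a]; exact_mod_cast (Real.sqrt_pos.2 (half_pos hl)).ne'
  have hb : b ≠ 0 := by simp only [b]; exact_mod_cast (Real.sqrt_pos.2 hl).ne'
  have ha2 : (starRingEnd ℂ) a * a = l / 2 := by
    simp only [a, Complex.conj_ofReal, ← Complex.ofReal_mul,
      Real.mul_self_sqrt (half_pos hl).le]
    simp
  have hb2 : (starRingEnd ℂ) b * b = l := by
    simp only [b, Complex.conj_ofReal, ← Complex.ofReal_mul, Real.mul_self_sqrt hl.le]
  let S : E →ₗ[ℂ] L2 × L2Field × L2 :=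
    { toFun := fun z => (z.fst, a⁻¹ • z.snd.fst, b⁻¹ • z.snd.snd)
      map_add' := fun z z' => Prod.ext rfl (Prod.ext (smul_add _ _ _) (smul_add _ _ _))
      map_smul' := fun c z => Prod.ext rfl (Prod.ext (smul_comm _ _ _) (smul_comm _ _ _)) }
  have hS : Continuous S := by
    change Continuous fun z : E => (z.fst, a⁻¹ • z.snd.fst, b⁻¹ • z.snd.snd)
    fun_prop
  let K : Submodule ℂ E := (formDomain Ω V).comap S
  have hK : IsClosed (K : Set E) :=
    (Submodule.isClosed_topologicalClosure _).preimage hS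
  have : CompleteSpace K := hK.completeSpace_coe
  let z₀ : E := WithLp.toLp 2 (f, 0)
  let z : E := K.starProjection z₀
  have hz : z ∈ K := K.starProjection_apply_mem z₀
  refine ⟨S z, (l : ℂ)⁻¹ • (f - z.fst), ⟨hz, fun k hk => ?_⟩, ?_⟩
  · let k' : E := WithLp.toLp 2 (k.1, WithLp.toLp 2 (a • k.2.1, b • k.2.2))
    have hk' : S k' = k := by
      change (k.1, a⁻¹ • a • k.2.1, b⁻¹ • b • k.2.2) = k
      rw [smul_smul, smul_smul, inv_mul_cancel₀ ha, inv_mul_cancel₀ hb, one_smul, one_smul]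
    have hk'' : k' ∈ K := by
      change S k' ∈ formDomain Ω V
      rw [hk']
      exact hk
    have h0 : ⟪k', z₀ - z⟫_ℂ = 0 :=
      Submodule.inner_right_of_mem_orthogonal hk'' (K.sub_starProjection_mem_orthogonal z₀)
    have h1 : ⟪k.1, f - z.fst⟫_ℂ + (⟪a • k.2.1, 0 - z.snd.fst⟫_ℂ
        + ⟪b • k.2.2, 0 - z.snd.snd⟫_ℂ) = 0 := h0
    rw [inner_smul_left, inner_smul_left, zero_sub, zero_sub, inner_neg_right,
      inner_neg_right] at h1
    change (1 / 2 : ℂ) * ⟪k.2.1, a⁻¹ • z.snd.fst⟫_ℂ + ⟪k.2.2, b⁻¹ • z.snd.snd⟫_ℂ = _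
    rw [inner_smul_right, inner_smul_right, inner_smul_right]
    have hl' : (l : ℂ) ≠ 0 := by exact_mod_cast hl.ne'
    have e : ⟪k.1, f - z.fst⟫_ℂ = (starRingEnd ℂ) a * ⟪k.2.1, z.snd.fst⟫_ℂ
        + (starRingEnd ℂ) b * ⟪k.2.2, z.snd.snd⟫_ℂ := by linear_combination h1
    rw [e]
    have ea : (starRingEnd ℂ) a = l / 2 * a⁻¹ := by rw [← ha2]; field_simp
    have eb : (starRingEnd ℂ) b = l * b⁻¹ := by rw [← hb2]; field_simp
    rw [ea, eb]
    field_simp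
  · have hl' : (l : ℂ) ≠ 0 := by exact_mod_cast hl.ne'
    rw [smul_smul, mul_inv_cancel₀ hl', one_smul]
    exact add_sub_cancel _ _

theorem isNonnegSelfAdjoint_schrodingerGraph (hΩ : IsOpen Ω) (hΩ' : volume Ωᶜ = 0) :
    IsNonnegSelfAdjoint (schrodingerGraph Ω V) where
  snd_eq_zero η h := by
    obtain ⟨g, w, h⟩ := mem_schrodingerGraph_iff.1 h
    have e := h.energy
    simp only [inner_zero_left, Complex.zero_re] at e
    have hg : g = 0 := norm_eq_zero.1 (by nlinarith [norm_nonneg g, sq_nonneg ‖w‖])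
    have hw : w = 0 := norm_eq_zero.1 (by nlinarith [norm_nonneg w, sq_nonneg ‖g‖])
    refine eq_zero_of_inner_test (V := V) hΩ hΩ' fun φ => ?_
    rw [← h.2 _ (formMap_mem_formDomain φ), hg, hw]
    simp
  symm := by
    rintro ⟨x, y⟩ hp ⟨x', y'⟩ hq
    obtain ⟨g, w, h⟩ := mem_schrodingerGraph_iff.1 hp
    obtain ⟨g', w', h'⟩ := mem_schrodingerGraph_iff.1 hq
    have e1 := h.2 _ h'.1
    have e2 := h'.2 _ h.1
    simp only at e1 e2 ⊢
    rw [← e2, ← inner_conj_symm y x', ← e1]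
    simp [Complex.conj_ofNat]
  nonneg := by
    rintro ⟨x, y⟩ hp
    obtain ⟨g, w, h⟩ := mem_schrodingerGraph_iff.1 hp
    rw [h.energy]
    positivity
  surj l hl f := by
    obtain ⟨p, η, h, e⟩ := exists_weakSolution (Ω := Ω) (V := V) l hl f
    exact ⟨(p.1, η), mem_schrodingerGraph_iff.2 ⟨p.2.1, p.2.2, h⟩, e⟩

theorem schrodinger_graph (hΩ : IsOpen Ω) (hΩ' : volume Ωᶜ = 0) :
    (schrodinger Ω V).graph = schrodingerGraph Ω V := by
  refine Submodule.toLinearPMap_graph_eq _ ?_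
  rintro ⟨x, y⟩ hx rfl
  exact (isNonnegSelfAdjoint_schrodingerGraph hΩ hΩ').snd_eq_zero y hx

theorem isUnitaryGroupOf_evolution (hΩ : IsOpen Ω) (hΩ' : volume Ωᶜ = 0) :
    IsUnitaryGroupOf (schrodinger Ω V) (evolution (schrodinger Ω V)) := by
  have h : ∃ U, IsUnitaryGroupOf (schrodinger Ω V) U := by
    obtain ⟨U, h1, h2, h3, h4, h5⟩ :=
      (isNonnegSelfAdjoint_schrodingerGraph (V := V) hΩ hΩ').exists_unitaryGroup
    refine ⟨U, h1, h2, h3, h4, fun ψ η => ?_⟩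
    rw [schrodinger_graph hΩ hΩ']
    exact h5 ψ η
  have e : evolution (schrodinger Ω V) = h.choose := by
    funext t
    exact dif_pos h
  rw [e]
  exact h.choose_spec

/-- The level set is porous. From a point `q` of it, move `2rδ` towards a nearest point of the
closure of `Γ`; the ball of radius `rδ` there lies in `{d < δ}`, since `d ≤ (1 - r)δ` on it. This
holds at arbitrarily small scales, contradicting Lebesgue density for balls that contain `q` after
doubling. -/
theorem measure_infDist_eq (Γ : Set Plane) (hΓ : Γ.Nonempty) {δ : ℝ} (hδ : 0 < δ) :
    volume {q | Metric.infDist q Γ = δ} = 0 := by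
  set S := {q : Plane | Metric.infDist q Γ = δ} with hSdef
  have hS : MeasurableSet S :=
    (isClosed_eq (Metric.continuous_infDist_pt Γ) continuous_const).measurableSet
  have key : ∀ᵐ x ∂(volume.restrict S), x ∉ S := by
    filter_upwards [IsUnifLocDoublingMeasure.ae_tendsto_measure_inter_div
      (volume : Measure Plane) S 2] with q hq hqS
    obtain ⟨p, hp, hpd⟩ := isClosed_closure.exists_infDist_eq_dist hΓ.closure q
    rw [Metric.infDist_closure, show Metric.infDist q Γ = δ from hqS] at hpd
    let r : ℕ → ℝ := fun n => (1 / ((n : ℝ) + 1)) / 2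
    have hr : ∀ n, 0 < r n := fun n => by positivity
    have hr1 : ∀ n, r n ≤ 1 / 2 := fun n => by
      have : 1 / ((n : ℝ) + 1) ≤ 1 := by
        rw [div_le_one (by positivity)]
        linarith [n.cast_nonneg (α := ℝ)]
      simp only [r]
      linarith
    have hr0 : Tendsto r atTop (𝓝 0) := by
      have := (tendsto_one_div_add_atTop_nhds_zero_nat (𝕜 := ℝ)).div_const 2
      rwa [zero_div] at this
    let w : ℕ → Plane := fun n => AffineMap.lineMap q p (2 * r n)
    have h1 : ∀ n, dist (w n) q = 2 * r n * δ := fun n => by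
      rw [dist_lineMap_left, ← hpd, Real.norm_of_nonneg (by linarith [hr n])]
    have h2 : ∀ n, dist (w n) p = (1 - 2 * r n) * δ := fun n => by
      rw [dist_lineMap_right, ← hpd, Real.norm_of_nonneg (by linarith [hr1 n])]
    have h3 := hq (l := atTop) w (fun n => r n * δ) ?_ ?_
    · have h4 : ∀ n, volume (S ∩ Metric.closedBall (w n) (r n * δ)) = 0 := by
        intro n
        have : S ∩ Metric.closedBall (w n) (r n * δ) = ∅ := by
          rw [Set.eq_empty_iff_forall_notMem]
          rintro x ⟨hx, hx'⟩
          have h5 : Metric.infDist x Γ ≤ dist x p := by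
            rw [← Metric.infDist_closure]
            exact Metric.infDist_le_dist_of_mem hp
          have h6 := dist_triangle x (w n) p
          rw [Metric.mem_closedBall] at hx'
          rw [show Metric.infDist x Γ = δ from hx] at h5
          rw [h2] at h6
          nlinarith [mul_pos (hr n) hδ]
        rw [this, measure_empty]
      simp only [h4, ENNReal.zero_div] at h3
      exact zero_ne_one (tendsto_nhds_unique tendsto_const_nhds h3)
    · refine tendsto_nhdsWithin_iff.2 ⟨by simpa using hr0.mul_const δ, ?_⟩
      exact Eventually.of_forall fun n => mul_pos (hr n) hδ
    · refine Eventually.of_forall fun n => ?_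
      rw [Metric.mem_closedBall, dist_comm, h1]
      linarith
  rw [ae_restrict_iff' hS, ae_iff] at key
  refine measure_mono_null (fun x hx => ?_) key
  simpa using hx

end

section

/-! ### Multiplication operators -/

section Mul

variable {E F : Type*} [NormedAddCommGroup E] [NormedAddCommGroup F]

theorem memLp_apply [NormedSpace ℂ E] [NormedSpace ℂ F] {a : Plane → E →L[ℂ] F}
    (ha : Continuous a) {C : ℝ} (hC : ∀ q, ‖a q‖ ≤ C) (ψ : Lp E 2 (volume : Measure Plane)) :
    MemLp (fun q => a q (ψ q)) 2 volume := by
  refine MemLp.of_le_mul (c := C) (Lp.memLp ψ) ?_ (Eventually.of_forall fun q => ?_)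
  · exact isBoundedBilinearMap_apply.continuous.comp_aestronglyMeasurable
      (ha.aestronglyMeasurable.prodMk (Lp.aestronglyMeasurable ψ))
  · exact (a q).le_of_opNorm_le (hC q) _

/-- Multiplication by a bounded continuous field of operators. -/
def fieldMul [NormedSpace ℂ E] [NormedSpace ℂ F] (a : Plane → E →L[ℂ] F)
    (ha : Continuous a) (C : ℝ) (hC : ∀ q, ‖a q‖ ≤ C) :
    Lp E 2 (volume : Measure Plane) →L[ℂ] Lp F 2 (volume : Measure Plane) :=
  LinearMap.mkContinuous
    { toFun := fun ψ => (memLp_apply ha hC ψ).toLp _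
      map_add' := fun ψ χ => by
        rw [← MemLp.toLp_add, MemLp.toLp_eq_toLp_iff]
        filter_upwards [Lp.coeFn_add ψ χ] with q hq
        change a q ((ψ + χ : Lp E 2 (volume : Measure Plane)) q) = a q (ψ q) + a q (χ q)
        rw [hq, Pi.add_apply, map_add]
      map_smul' := fun c ψ => by
        rw [← MemLp.toLp_const_smul, MemLp.toLp_eq_toLp_iff]
        filter_upwards [Lp.coeFn_smul c ψ] with q hq
        change a q ((c • ψ : Lp E 2 (volume : Measure Plane)) q) = c • a q (ψ q)
        rw [hq, Pi.smul_apply, map_smul] } C fun ψ => by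
    refine Lp.norm_le_mul_norm_of_ae_le_mul ?_
    filter_upwards [(memLp_apply ha hC ψ).coeFn_toLp] with q hq
    rw [LinearMap.coe_mk, AddHom.coe_mk, hq]
    exact (a q).le_of_opNorm_le (hC q) _

theorem coeFn_fieldMul [NormedSpace ℂ E] [NormedSpace ℂ F] {a : Plane → E →L[ℂ] F}
    (ha : Continuous a) {C : ℝ} (hC : ∀ q, ‖a q‖ ≤ C) (ψ : Lp E 2 (volume : Measure Plane)) :
    fieldMul a ha C hC ψ =ᵐ[volume] fun q => a q (ψ q) :=
  (memLp_apply ha hC ψ).coeFn_toLp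

/-- Multiplication by a continuous function with values in `[-1, 1]`. -/
def scalarMul [NormedSpace ℂ E] (m : Plane → ℝ) (hm : Continuous m) (hb : ∀ q, |m q| ≤ 1) :
    Lp E 2 (volume : Measure Plane) →L[ℂ] Lp E 2 (volume : Measure Plane) :=
  fieldMul (fun q => (m q : ℂ) • ContinuousLinearMap.id ℂ E) (by fun_prop) 1 fun q => by
    rw [norm_smul, Complex.norm_real, Real.norm_eq_abs]
    exact mul_le_one₀ (hb q) (norm_nonneg _) ContinuousLinearMap.norm_id_le

theorem coeFn_scalarMul [NormedSpace ℂ E] {m : Plane → ℝ} (hm : Continuous m)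
    (hb : ∀ q, |m q| ≤ 1) (ψ : Lp E 2 (volume : Measure Plane)) :
    scalarMul m hm hb ψ =ᵐ[volume] fun q => (m q : ℂ) • ψ q := by
  filter_upwards [coeFn_fieldMul (a := fun q => (m q : ℂ) • ContinuousLinearMap.id ℂ E)
    (by fun_prop) (C := 1) _ ψ] with q hq
  exact hq

theorem inner_scalarMul [InnerProductSpace ℂ E] {m : Plane → ℝ} (hm : Continuous m)
    (hb : ∀ q, |m q| ≤ 1) (ψ χ : Lp E 2 (volume : Measure Plane)) :
    ⟪scalarMul m hm hb ψ, χ⟫_ℂ = ⟪ψ, scalarMul m hm hb χ⟫_ℂ := by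
  rw [L2.inner_def, L2.inner_def]
  refine integral_congr_ae ?_
  filter_upwards [coeFn_scalarMul hm hb ψ, coeFn_scalarMul hm hb χ] with q h1 h2
  rw [h1, h2, inner_smul_left, inner_smul_right, Complex.conj_ofReal]

end Mul

/-- A smooth function with values in `[0, 1]` and gradient bounded by `D`. -/
structure Cutoff (D : ℝ) where
  /-- the underlying function -/
  toFun : Plane → ℝ
  smooth : ContDiff ℝ ∞ toFun
  nonneg : ∀ q, 0 ≤ toFun q
  le_one : ∀ q, toFun q ≤ 1
  grad_le : ∀ q, ‖grad (fun q => (toFun q : ℂ)) q‖ ≤ D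

/-! ### Cutoff functions as bounded operators. -/

namespace Cutoff

variable {D : ℝ} (F : Cutoff D) {E : Type*} [NormedAddCommGroup E]

theorem abs_le (q : Plane) : |F.toFun q| ≤ 1 := by
  rw [abs_of_nonneg (F.nonneg q)]
  exact F.le_one q

theorem contDiff_coe : ContDiff ℝ ∞ fun q => (F.toFun q : ℂ) :=
  Complex.ofRealCLM.contDiff.comp F.smooth

theorem continuous_grad : Continuous (grad fun q => (F.toFun q : ℂ)) := by
  have hc := F.contDiff_coe.continuous_fderiv (by simp)
  unfold grad
  fun_prop

/-- Multiplication by a cutoff function. -/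
def mul [NormedSpace ℂ E] :
    Lp E 2 (volume : Measure Plane) →L[ℂ] Lp E 2 (volume : Measure Plane) :=
  scalarMul F.toFun F.smooth.continuous F.abs_le

/-- Multiplication by the gradient of a cutoff function. -/
def gradMul : L2 →L[ℂ] L2Field :=
  fieldMul (fun q => ContinuousLinearMap.toSpanSingleton ℂ (grad (fun q => (F.toFun q : ℂ)) q))
    ((ContinuousLinearMap.toSpanSingletonCLE (𝕜 := ℂ)
      (E := EuclideanSpace ℂ (Fin 2))).continuous.comp F.continuous_grad) D
    fun q => by
      rw [ContinuousLinearMap.norm_toSpanSingleton]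
      exact F.grad_le q

theorem coeFn_mul [NormedSpace ℂ E] (ψ : Lp E 2 (volume : Measure Plane)) :
    F.mul ψ =ᵐ[volume] fun q => (F.toFun q : ℂ) • ψ q :=
  coeFn_scalarMul _ _ ψ

theorem coeFn_gradMul (ψ : L2) :
    F.gradMul ψ =ᵐ[volume] fun q => ψ q • grad (fun q => (F.toFun q : ℂ)) q := by
  filter_upwards [coeFn_fieldMul (a := fun q => ContinuousLinearMap.toSpanSingleton ℂ
    (grad (fun q => (F.toFun q : ℂ)) q)) _ _ ψ] with q hq
  exact hq

theorem inner_mul [InnerProductSpace ℂ E] (ψ χ : Lp E 2 (volume : Measure Plane)) :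
    ⟪F.mul ψ, χ⟫_ℂ = ⟪ψ, F.mul χ⟫_ℂ :=
  inner_scalarMul _ _ ψ χ

theorem norm_mul_le [NormedSpace ℂ E] (ψ : Lp E 2 (volume : Measure Plane)) :
    ‖F.mul ψ‖ ≤ ‖ψ‖ := by
  refine Lp.norm_le_norm_of_ae_le ?_
  filter_upwards [F.coeFn_mul ψ] with q hq
  rw [hq, norm_smul, Complex.norm_real, Real.norm_eq_abs]
  exact mul_le_of_le_one_left (norm_nonneg _) (F.abs_le q)

theorem norm_gradMul_le (ψ : L2) : ‖F.gradMul ψ‖ ≤ D * ‖ψ‖ := by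
  refine Lp.norm_le_mul_norm_of_ae_le_mul ?_
  filter_upwards [F.coeFn_gradMul ψ] with q hq
  rw [hq, norm_smul, mul_comm]
  exact mul_le_mul_of_nonneg_right (F.grad_le q) (norm_nonneg _)

theorem grad_sq (q : Plane) : grad (fun q => ((F.toFun q ^ 2 : ℝ) : ℂ)) q
    = (2 * F.toFun q : ℂ) • grad (fun q => (F.toFun q : ℂ)) q := by
  have hd : DifferentiableAt ℝ (fun q => (F.toFun q : ℂ)) q :=
    F.contDiff_coe.differentiable (by simp) q
  ext i
  have : (fun q => ((F.toFun q ^ 2 : ℝ) : ℂ)) = fun q => (F.toFun q : ℂ) * (F.toFun q : ℂ) := by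
    funext q
    push_cast
    ring
  rw [this]
  simp only [grad, fderiv_fun_mul hd hd, PiLp.smul_apply, smul_eq_mul,
    add_apply, smul_apply]
  ring

/-- The square of a cutoff function. -/
def sq : Cutoff (2 * D) where
  toFun q := F.toFun q ^ 2
  smooth := F.smooth.pow 2
  nonneg q := sq_nonneg _
  le_one q := pow_le_one₀ (F.nonneg q) (F.le_one q)
  grad_le q := by
    rw [F.grad_sq, norm_smul, norm_mul, Complex.norm_real, Real.norm_eq_abs, Complex.norm_ofNat,
      mul_assoc]
    refine mul_le_mul_of_nonneg_left ?_ zero_le_two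
    exact (mul_le_of_le_one_left (norm_nonneg _) (F.abs_le q)).trans (F.grad_le q)

theorem grad_compl (q : Plane) : grad (fun q => ((1 - F.toFun q : ℝ) : ℂ)) q
    = -grad (fun q => (F.toFun q : ℂ)) q := by
  ext i
  have : (fun q => ((1 - F.toFun q : ℝ) : ℂ)) = fun q => 1 - (F.toFun q : ℂ) := by
    funext q
    push_cast
    ring
  rw [this]
  simp [grad, fderiv_const_sub]

/-- The complementary cutoff function `1 - F`. -/
def compl : Cutoff D where
  toFun q := 1 - F.toFun q
  smooth := contDiff_const.sub F.smooth
  nonneg q := sub_nonneg.2 (F.le_one q)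
  le_one q := sub_le_self _ (F.nonneg q)
  grad_le q := by
    rw [F.grad_compl, norm_neg]
    exact F.grad_le q

theorem sq_mul [NormedSpace ℂ E] (ψ : Lp E 2 (volume : Measure Plane)) :
    F.sq.mul ψ = F.mul (F.mul ψ) := by
  refine Lp.ext ?_
  filter_upwards [F.sq.coeFn_mul ψ, F.coeFn_mul ψ, F.coeFn_mul (F.mul ψ)] with q h1 h2 h3
  rw [h1, h3, h2, smul_smul]
  simp [sq, pow_two]

theorem sq_gradMul (ψ : L2) : F.sq.gradMul ψ = (2 : ℂ) • F.mul (F.gradMul ψ) := by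
  refine Lp.ext ?_
  filter_upwards [F.sq.coeFn_gradMul ψ, F.coeFn_gradMul ψ, F.coeFn_mul (F.gradMul ψ),
    Lp.coeFn_smul (2 : ℂ) (F.mul (F.gradMul ψ))] with q h1 h2 h3 h4
  rw [h1, h4, Pi.smul_apply, h3, h2, sq, F.grad_sq]
  simp only [smul_smul]
  congr 1
  ring

theorem compl_mul [NormedSpace ℂ E] (ψ : Lp E 2 (volume : Measure Plane)) :
    F.compl.mul ψ = ψ - F.mul ψ := by
  refine Lp.ext ?_
  filter_upwards [F.compl.coeFn_mul ψ, F.coeFn_mul ψ, Lp.coeFn_sub ψ (F.mul ψ)] with q h1 h2 h3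
  rw [h1, h3, Pi.sub_apply, h2, compl]
  simp [sub_smul]

end Cutoff

/-! ### Localizing the quadratic form. -/

variable {Ω Ω' : Set Plane} {V : C(Plane, ℝ)} {D : ℝ}

/-- The Leibniz rule for test functions passes to the closure because all multipliers are bounded.
The support condition lets one cutoff carry free form vectors into the Dirichlet form domain, and
trivially back. -/
theorem formDomain_mul (F : Cutoff D) (h : tsupport F.toFun ∩ Ω ⊆ Ω')
    {p : L2 × L2Field × L2} (hp : p ∈ formDomain Ω V) :
    (F.mul p.1, F.mul p.2.1 + F.gradMul p.1, F.mul p.2.2) ∈ formDomain Ω' V := by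
  refine formDomain_induction (P := fun p =>
    (F.mul p.1, F.mul p.2.1 + F.gradMul p.1, F.mul p.2.2) ∈ formDomain Ω' V) ?_ ?_ hp
  · exact (Submodule.isClosed_topologicalClosure _).preimage (f := fun p : L2 × L2Field × L2 =>
      (F.mul p.1, F.mul p.2.1 + F.gradMul p.1, F.mul p.2.2)) (by fun_prop)
  · intro φ
    have hs : tsupport (fun q => (F.toFun q : ℂ)) ⊆ tsupport F.toFun :=
      tsupport_comp_subset (g := fun x : ℝ => (x : ℂ)) Complex.ofReal_zero _
    let χ : testFunctions Ω' := ⟨fun q => (F.toFun q : ℂ) * (φ : Plane → ℂ) q,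
      F.contDiff_coe.mul φ.2.1, φ.2.2.1.mul_left, fun q hq => h ⟨hs (tsupport_mul_subset_left hq),
        φ.2.2.2 (tsupport_mul_subset_right hq)⟩⟩
    have e : (F.mul (formMap Ω V φ).1, F.mul (formMap Ω V φ).2.1 + F.gradMul (formMap Ω V φ).1,
        F.mul (formMap Ω V φ).2.2) = formMap Ω' V χ := by
      have a1 : (formMap Ω V φ).1 =ᵐ[volume] (φ : Plane → ℂ) := (memLp_test φ).coeFn_toLp
      have a2 : (formMap Ω V φ).2.1 =ᵐ[volume] grad (φ : Plane → ℂ) := (memLp_grad φ).coeFn_toLp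
      have a3 : (formMap Ω V φ).2.2 =ᵐ[volume]
          fun q => (Real.sqrt (V q) : ℂ) * (φ : Plane → ℂ) q := (memLp_sqrt_mul V φ).coeFn_toLp
      have b1 : (formMap Ω' V χ).1 =ᵐ[volume] (χ : Plane → ℂ) := (memLp_test χ).coeFn_toLp
      have b2 : (formMap Ω' V χ).2.1 =ᵐ[volume] grad (χ : Plane → ℂ) :=
        (memLp_grad χ).coeFn_toLp
      have b3 : (formMap Ω' V χ).2.2 =ᵐ[volume]
          fun q => (Real.sqrt (V q) : ℂ) * (χ : Plane → ℂ) q := (memLp_sqrt_mul V χ).coeFn_toLp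
      refine Prod.ext (Lp.ext ?_) (Prod.ext (Lp.ext ?_) (Lp.ext ?_))
      · filter_upwards [a1, b1, F.coeFn_mul (formMap Ω V φ).1] with q h1 h2 h3
        rw [h2, h3, h1]
        rfl
      · filter_upwards [a1, a2, b2, F.coeFn_mul (formMap Ω V φ).2.1,
          F.coeFn_gradMul (formMap Ω V φ).1, Lp.coeFn_add (F.mul (formMap Ω V φ).2.1)
          (F.gradMul (formMap Ω V φ).1)] with q h1 h2 h3 h4 h5 h6
        rw [h6, Pi.add_apply, h3, h4, h5, h1, h2]
        have hd1 : DifferentiableAt ℝ (fun q => (F.toFun q : ℂ)) q :=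
          F.contDiff_coe.differentiable (by simp) q
        have hd2 : DifferentiableAt ℝ (φ : Plane → ℂ) q := φ.2.1.differentiable (by simp) q
        ext i
        simp only [χ, grad, fderiv_fun_mul hd1 hd2, PiLp.smul_apply, PiLp.add_apply, smul_eq_mul,
          add_apply, smul_apply]
      · filter_upwards [a3, b3, F.coeFn_mul (formMap Ω V φ).2.2] with q h1 h2 h3
        rw [h2, h3, h1]
        simp only [χ, smul_eq_mul]
        ring
    rw [e]
    exact formMap_mem_formDomain χ

/-- Multiplication by `√V` is unbounded, so the identity is divided by `1 + √V`: both sides become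
bounded multipliers, and the identity is a closed condition. -/
theorem formDomain_coeFn {p : L2 × L2Field × L2} (hp : p ∈ formDomain Ω V) :
    p.2.2 =ᵐ[volume] fun q => (Real.sqrt (V q) : ℂ) * p.1 q := by
  have hc : Continuous fun q => Real.sqrt (V q) := by fun_prop
  have hpos : ∀ q, 0 < 1 + Real.sqrt (V q) := fun q => by positivity
  have hb1 : ∀ q, |1 / (1 + Real.sqrt (V q))| ≤ 1 := fun q => by
    rw [abs_of_pos (by have := hpos q; positivity), div_le_one (hpos q)]
    linarith [Real.sqrt_nonneg (V q)]
  have hb2 : ∀ q, |Real.sqrt (V q) / (1 + Real.sqrt (V q))| ≤ 1 := fun q => by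
    rw [abs_of_nonneg (by have := hpos q; positivity), div_le_one (hpos q)]
    linarith
  have hm1 : Continuous fun q => 1 / (1 + Real.sqrt (V q)) :=
    continuous_const.div (continuous_const.add hc) fun q => (hpos q).ne'
  have hm2 : Continuous fun q => Real.sqrt (V q) / (1 + Real.sqrt (V q)) :=
    hc.div (continuous_const.add hc) fun q => (hpos q).ne'
  have key : scalarMul _ hm1 hb1 p.2.2 = scalarMul _ hm2 hb2 p.1 := by
    refine formDomain_induction (P := fun p =>
      scalarMul _ hm1 hb1 p.2.2 = scalarMul _ hm2 hb2 p.1)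
      (isClosed_eq (by fun_prop) (by fun_prop)) (fun φ => Lp.ext ?_) hp
    have a1 : (formMap Ω V φ).1 =ᵐ[volume] (φ : Plane → ℂ) := (memLp_test φ).coeFn_toLp
    have a3 : (formMap Ω V φ).2.2 =ᵐ[volume]
        fun q => (Real.sqrt (V q) : ℂ) * (φ : Plane → ℂ) q := (memLp_sqrt_mul V φ).coeFn_toLp
    filter_upwards [a1, a3, coeFn_scalarMul hm1 hb1 (formMap Ω V φ).2.2,
      coeFn_scalarMul hm2 hb2 (formMap Ω V φ).1] with q h1 h2 h3 h4
    rw [h3, h4, h1, h2, smul_eq_mul, smul_eq_mul]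
    push_cast
    ring
  have key' : scalarMul _ hm1 hb1 p.2.2 =ᵐ[volume] scalarMul _ hm2 hb2 p.1 := by rw [key]
  filter_upwards [key', coeFn_scalarMul hm1 hb1 p.2.2, coeFn_scalarMul hm2 hb2 p.1]
    with q h1 h2 h3
  rw [h2, h3, smul_eq_mul, smul_eq_mul] at h1
  have hne : ((1 + Real.sqrt (V q) : ℝ) : ℂ) ≠ 0 := by exact_mod_cast (hpos q).ne'
  push_cast at h1 hne
  field_simp at h1
  exact h1

/-- Test with `F²ψ`. The cross term `⟪ψ∇F, F∇ψ⟫` is absorbed by Young's inequality, which uses up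
half of the kinetic coefficient `1/2`. -/
theorem IsWeakSolution.localized_energy {p : L2 × L2Field × L2} {η : L2}
    (h : IsWeakSolution Ω V p η) (F : Cutoff D) :
    1 / 4 * ‖F.mul p.2.1‖ ^ 2 + ‖F.mul p.2.2‖ ^ 2
      ≤ ‖F.mul p.1‖ * ‖F.mul η‖ + ‖F.gradMul p.1‖ ^ 2 := by
  have e := h.2 _ (formDomain_mul F.sq Set.inter_subset_right h.1)
  simp only [F.sq_mul, F.sq_gradMul, F.inner_mul (F.mul _), inner_add_left, inner_smul_left,
    F.inner_mul (F.gradMul _), Complex.conj_ofNat] at e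
  have h1 : (⟪F.mul p.2.1, F.mul p.2.1⟫_ℂ).re = ‖F.mul p.2.1‖ ^ 2 :=
    inner_self_eq_norm_sq (𝕜 := ℂ) _
  have h2 : (⟪F.mul p.2.2, F.mul p.2.2⟫_ℂ).re = ‖F.mul p.2.2‖ ^ 2 :=
    inner_self_eq_norm_sq (𝕜 := ℂ) _
  have h3 : (⟪F.mul p.1, F.mul η⟫_ℂ).re ≤ ‖F.mul p.1‖ * ‖F.mul η‖ :=
    re_inner_le_norm (𝕜 := ℂ) _ _
  have h4 : |(⟪F.gradMul p.1, F.mul p.2.1⟫_ℂ).re| ≤ ‖F.gradMul p.1‖ * ‖F.mul p.2.1‖ :=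
    (Complex.abs_re_le_norm _).trans (norm_inner_le_norm _ _)
  have e' : 1 / 2 * ⟪F.mul p.2.1, F.mul p.2.1⟫_ℂ + ⟪F.gradMul p.1, F.mul p.2.1⟫_ℂ
      + ⟪F.mul p.2.2, F.mul p.2.2⟫_ℂ = ⟪F.mul p.1, F.mul η⟫_ℂ := by
    rw [← e]
    ring
  have e'' := congrArg Complex.re e'
  rw [Complex.add_re, Complex.add_re, show (1 / 2 : ℂ) = ((1 / 2 : ℝ) : ℂ) by simp,
    Complex.re_ofReal_mul, h1, h2] at e''
  nlinarith [sq_nonneg (1 / 2 * ‖F.mul p.2.1‖ - ‖F.gradMul p.1‖), (abs_le.1 h4).1]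

end

/-! ### Smooth functions of the distance -/

/-- Average over a smooth probability density supported within radius `r`: this keeps the Lipschitz
constant and moves values by at most `r`. -/
theorem exists_smooth_lipschitz_approx {d : Plane → ℝ} (hd : LipschitzWith 1 d) {r : ℝ}
    (hr : 0 < r) :
    ∃ f : Plane → ℝ, ContDiff ℝ ∞ f ∧ LipschitzWith 1 f ∧ ∀ q, |f q - d q| ≤ r := by
  let φ : ContDiffBump (0 : Plane) := ⟨r / 2, r, half_pos hr, half_lt_self hr⟩
  let f : Plane → ℝ :=
    MeasureTheory.convolution (φ.normed volume) d (ContinuousLinearMap.lsmul ℝ ℝ) volume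
  have hc : HasCompactSupport (φ.normed volume) := φ.hasCompactSupport_normed
  have hsm : ContDiff ℝ ∞ (φ.normed volume) := φ.contDiff_normed
  have hloc : LocallyIntegrable d volume := hd.continuous.locallyIntegrable
  refine ⟨f, hc.contDiff_convolution_left _ hsm hloc, ?_, fun q => ?_⟩
  · have hex := hc.convolutionExists_left (ContinuousLinearMap.lsmul ℝ ℝ) hsm.continuous hloc
    refine LipschitzWith.of_dist_le_mul fun x y => ?_
    have h1 : f x - f y = ∫ t, φ.normed volume t * (d (x - t) - d (y - t)) := by
      change (∫ t, φ.normed volume t * d (x - t)) - (∫ t, φ.normed volume t * d (y - t)) = _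
      refine (integral_sub (hex x) (hex y)).symm.trans (integral_congr_ae ?_)
      exact Eventually.of_forall fun t => (mul_sub _ _ _).symm
    have h2 : ‖f x - f y‖ ≤ ∫ t, φ.normed volume t * dist x y := by
      rw [h1]
      refine norm_integral_le_of_norm_le
        ((hsm.continuous.integrable_of_hasCompactSupport hc).mul_const _)
        (Eventually.of_forall fun t => ?_)
      rw [norm_mul, Real.norm_of_nonneg (φ.nonneg_normed t)]
      refine mul_le_mul_of_nonneg_left ?_ (φ.nonneg_normed t)
      have := hd.dist_le_mul (x - t) (y - t)
      simpa [Real.dist_eq] using this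
    rwa [integral_mul_const, φ.integral_normed, one_mul, ← dist_eq_norm,
      ← one_mul (dist x y)] at h2
  · rw [← Real.dist_eq]
    refine φ.dist_normed_convolution_le hd.continuous.aestronglyMeasurable fun x hx => ?_
    have := hd.dist_le_mul x q
    rw [Metric.mem_ball] at hx
    simp only [NNReal.coe_one, one_mul] at this
    exact this.trans hx.le

theorem exists_bound_deriv_smoothTransition :
    ∃ C : ℝ, 0 < C ∧ ∀ x, |deriv Real.smoothTransition x| ≤ C := by
  have h1 : Continuous (deriv Real.smoothTransition) :=
    (Real.smoothTransition.contDiff (n := 1)).continuous_deriv le_rfl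
  have h2 : HasCompactSupport (deriv Real.smoothTransition) := by
    refine HasCompactSupport.intro (isCompact_Icc (a := (0 : ℝ)) (b := 1)) fun x hx => ?_
    rw [Set.mem_Icc, not_and_or, not_le, not_le] at hx
    rcases hx with hx | hx
    · have : Real.smoothTransition =ᶠ[𝓝 x] fun _ => 0 := by
        filter_upwards [Iio_mem_nhds hx] with y hy
        exact Real.smoothTransition.zero_of_nonpos hy.le
      rw [this.deriv_eq, deriv_const]
    · have : Real.smoothTransition =ᶠ[𝓝 x] fun _ => 1 := by
        filter_upwards [Ioi_mem_nhds hx] with y hy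
        exact Real.smoothTransition.one_of_one_le hy.le
      rw [this.deriv_eq, deriv_const]
  obtain ⟨C, hC⟩ := h1.bounded_above_of_compact_support h2
  exact ⟨|C| + 1, by positivity, fun x => (hC x).trans (by linarith [le_abs_self C])⟩

theorem norm_grad_ofReal_le {f : Plane → ℝ} {q : Plane} (hf : DifferentiableAt ℝ f q) :
    ‖grad (fun q => (f q : ℂ)) q‖ ≤ 2 * ‖fderiv ℝ f q‖ := by
  have h : fderiv ℝ (fun q => (f q : ℂ)) q = Complex.ofRealCLM.comp (fderiv ℝ f q) :=
    (Complex.ofRealCLM.hasFDerivAt.comp q hf.hasFDerivAt).fderiv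
  have h1 : ∀ i : Fin 2, ‖grad (fun q => (f q : ℂ)) q i‖ ≤ ‖fderiv ℝ f q‖ := fun i => by
    simp only [grad, h]
    have := (fderiv ℝ f q).le_opNorm (EuclideanSpace.single i (1 : ℝ))
    simpa using this
  rw [EuclideanSpace.norm_eq, Real.sqrt_le_iff, Fin.sum_univ_two]
  refine ⟨by positivity, ?_⟩
  have h2 := pow_le_pow_left₀ (norm_nonneg _) (h1 0) 2
  have h3 := pow_le_pow_left₀ (norm_nonneg _) (h1 1) 2
  nlinarith [sq_nonneg ‖fderiv ℝ f q‖]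

/-- Smooth cutoffs in terms of the distance from a set, with a universal gradient bound. -/
theorem exists_cutoff : ∃ L : ℝ, 0 < L ∧ ∀ (Γ : Set Plane) (a h : ℝ), 0 < h →
    ∃ F : Cutoff (L / h), (∀ q, Metric.infDist q Γ ≤ a → F.toFun q = 0) ∧
      (∀ q, a + h ≤ Metric.infDist q Γ → F.toFun q = 1) ∧
      ∀ q, Metric.infDist q Γ < a → grad (fun q => (F.toFun q : ℂ)) q = 0 := by
  obtain ⟨C, hC, hCb⟩ := exists_bound_deriv_smoothTransition
  -- The mollified distance `f` is within `r = h/3` of the distance, so a transition over `f ∈ [a +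
  -- r, a + 2r]` is complete by distance `a + h`. The gradient is at most `2 · C · r⁻¹ = 6C/h`.
  refine ⟨6 * C, by positivity, fun Γ a h hh => ?_⟩
  have hr : 0 < h / 3 := by linarith
  obtain ⟨f, hf, hfl, hfd⟩ := exists_smooth_lipschitz_approx
    (Metric.lipschitz_infDist_pt Γ) hr
  set r := h / 3
  let F : Plane → ℝ := fun q => Real.smoothTransition (r⁻¹ * (f q - (a + r)))
  have hF : ContDiff ℝ ∞ F :=
    Real.smoothTransition.contDiff.comp (contDiff_const.mul (hf.sub contDiff_const))
  have h0 : ∀ q, Metric.infDist q Γ ≤ a → F q = 0 := fun q hq => by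
    refine Real.smoothTransition.zero_of_nonpos ?_
    refine mul_nonpos_of_nonneg_of_nonpos (by positivity) ?_
    linarith [(abs_le.1 (hfd q)).2]
  have h1 : ∀ q, a + h ≤ Metric.infDist q Γ → F q = 1 := fun q hq => by
    refine Real.smoothTransition.one_of_one_le ?_
    rw [inv_mul_eq_div, one_le_div hr]
    have : h = 3 * r := by simp only [r]; ring
    linarith [(abs_le.1 (hfd q)).1]
  refine ⟨⟨F, hF, fun q => Real.smoothTransition.nonneg _, fun q => Real.smoothTransition.le_one _,
    fun q => ?_⟩, h0, h1, fun q hq => ?_⟩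
  · have hfq : HasFDerivAt f (fderiv ℝ f q) q := (hf.differentiable (by simp) q).hasFDerivAt
    have hs : HasDerivAt Real.smoothTransition
        (deriv Real.smoothTransition (r⁻¹ * (f q - (a + r)))) (r⁻¹ * (f q - (a + r))) :=
      ((Real.smoothTransition.contDiff (n := 1)).differentiable one_ne_zero _).hasDerivAt
    have h2 : HasFDerivAt F (deriv Real.smoothTransition (r⁻¹ * (f q - (a + r))) •
        r⁻¹ • fderiv ℝ f q) q :=
      HasDerivAt.comp_hasFDerivAt (h₂ := Real.smoothTransition)
        (f := fun q => r⁻¹ * (f q - (a + r))) q hs ((hfq.sub_const (a + r)).const_mul r⁻¹)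
    refine (norm_grad_ofReal_le h2.differentiableAt).trans ?_
    rw [h2.fderiv, norm_smul, norm_smul, Real.norm_eq_abs, Real.norm_of_nonneg (by positivity)]
    have h3 : ‖fderiv ℝ f q‖ ≤ 1 := by simpa using norm_fderiv_le_of_lipschitz ℝ hfl
    have h4 : r⁻¹ * ‖fderiv ℝ f q‖ ≤ r⁻¹ := mul_le_of_le_one_right (by positivity) h3
    calc _ ≤ 2 * (C * r⁻¹) := by
          refine mul_le_mul_of_nonneg_left ?_ zero_le_two
          exact mul_le_mul (hCb _) h4 (by positivity) hC.le
      _ = 6 * C / h := by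
          simp only [r]
          field_simp
          norm_num
  · have h2 : (fun q => (F q : ℂ)) =ᶠ[𝓝 q] fun _ => 0 := by
      filter_upwards [(Metric.continuous_infDist_pt Γ).tendsto q |>.eventually_lt_const hq]
        with y hy
      rw [h0 y hy.le, Complex.ofReal_zero]
    ext i
    simp [grad, h2.fderiv_eq]

section

/-! ### Dynamics -/

namespace IsUnitaryGroupOf

variable {A : L2 →ₗ.[ℂ] L2} {U : ℝ → L2 →L[ℂ] L2}

theorem norm_apply (hU : IsUnitaryGroupOf A U) (t : ℝ) (ψ : L2) : ‖U t ψ‖ = ‖ψ‖ :=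
  (ContinuousLinearMap.norm_map_iff_adjoint_comp_self _).2
    (Unitary.mem_iff.1 (hU.unitary t)).1 ψ

theorem inner_apply (hU : IsUnitaryGroupOf A U) (t : ℝ) (ψ χ : L2) :
    ⟪U t ψ, U t χ⟫_ℂ = ⟪ψ, χ⟫_ℂ := by
  rw [← ContinuousLinearMap.adjoint_inner_right]
  congr 1
  exact DFunLike.congr_fun (Unitary.mem_iff.1 (hU.unitary t)).1 χ

theorem hasDerivAt (hU : IsUnitaryGroupOf A U) {ψ η : L2} (h : (ψ, η) ∈ A.graph) (t : ℝ) :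
    HasDerivAt (fun s => U s ψ) (U t (-(Complex.I • η))) t := by
  have h1 := (hU.generator ψ η).1 h
  rw [← sub_self t] at h1
  have h2 : HasDerivAt (fun s => U (s - t) ψ) (-(Complex.I • η)) t := h1.comp_sub_const t t
  have h3 := ((U t).restrictScalars ℝ).hasFDerivAt.comp_hasDerivAt t h2
  have e : (fun s => U s ψ) = (U t).restrictScalars ℝ ∘ fun s => U (s - t) ψ := by
    funext s
    change U s ψ = (U t * U (s - t)) ψ
    rw [← hU.map_add, add_sub_cancel]
  rw [e]
  exact h3

theorem mem_graph (hU : IsUnitaryGroupOf A U) {ψ η : L2} (h : (ψ, η) ∈ A.graph) (t : ℝ) :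
    (U t ψ, U t η) ∈ A.graph := by
  rw [hU.generator]
  have h3 := ((U t).restrictScalars ℝ).hasFDerivAt.comp_hasDerivAt 0 ((hU.generator ψ η).1 h)
  have e : (fun s => U s (U t ψ)) = (U t).restrictScalars ℝ ∘ fun s => U s ψ := by
    funext s
    change (U s * U t) ψ = (U t * U s) ψ
    rw [← hU.map_add, ← hU.map_add, add_comm]
  rw [e, show -(Complex.I • U t η) = (U t).restrictScalars ℝ (-(Complex.I • η)) by simp]
  exact h3

end IsUnitaryGroupOf

/-! ### Confinement by the potential. -/

variable {Ω : Set Plane} {Γ : Set Plane} {ε δ : ℝ}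

theorem infDist_mul_norm_eq (hε : 0 < ε) {p : L2 × L2Field × L2}
    (hp : p ∈ formDomain Ω (constrainingPotential ε Γ)) :
    ∀ᵐ q, Metric.infDist q Γ * ‖p.1 q‖ = Real.sqrt 2 * ε * ‖p.2.2 q‖ := by
  filter_upwards [formDomain_coeFn hp] with q hq
  have h : constrainingPotential ε Γ q = (Metric.infDist q Γ / (Real.sqrt 2 * ε)) ^ 2 := by
    change 1 / ε ^ 2 * (1 / 2 * Metric.infDist q Γ ^ 2) = _
    rw [div_pow, mul_pow, Real.sq_sqrt zero_le_two]
    field_simp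
  rw [hq, h, Real.sqrt_sq (div_nonneg Metric.infDist_nonneg (by positivity)), norm_mul,
    Complex.norm_real, Real.norm_of_nonneg (div_nonneg Metric.infDist_nonneg (by positivity))]
  field_simp

theorem coeFn_cutoff {S : Set Plane} (hS : MeasurableSet S) (ψ : L2) :
    (cutoff S hS ψ : Plane → ℂ) =ᵐ[volume] S.indicator (ψ : Plane → ℂ) := by
  rw [cutoff]
  exact MemLp.coeFn_toLp _

/-- Chebyshev: `√V = d / (√2 ε)` is at least `δ / (√2 ε)` outside the tube. -/
theorem norm_outsideTube_le (hε : 0 < ε) (hδ : 0 < δ) {p : L2 × L2Field × L2}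
    (hp : p ∈ formDomain Ω (constrainingPotential ε Γ)) :
    ‖outsideTube δ Γ p.1‖ ≤ Real.sqrt 2 * ε / δ * ‖p.2.2‖ := by
  refine Lp.norm_le_mul_norm_of_ae_le_mul ?_
  have h1 : outsideTube δ Γ p.1 =ᵐ[volume] {q | δ ≤ Metric.infDist q Γ}.indicator p.1 :=
    coeFn_cutoff _ _
  filter_upwards [h1, infDist_mul_norm_eq hε hp] with q h2 h3
  rw [h2]
  by_cases hq : δ ≤ Metric.infDist q Γ
  · rw [Set.indicator_of_mem (show q ∈ {q | δ ≤ Metric.infDist q Γ} from hq),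
      div_mul_eq_mul_div, le_div_iff₀ hδ, ← h3, mul_comm]
    gcongr
  · rw [Set.indicator_of_notMem (show q ∉ {q | δ ≤ Metric.infDist q Γ} from hq), norm_zero]
    positivity

theorem norm_cutoff_mul_le (hε : 0 < ε) {c : ℝ} (hc : 0 < c) {D : ℝ} (F : Cutoff D)
    (hF : ∀ q, Metric.infDist q Γ ≤ c → F.toFun q = 0) {p : L2 × L2Field × L2}
    (hp : p ∈ formDomain Ω (constrainingPotential ε Γ)) :
    ‖F.mul p.1‖ ≤ Real.sqrt 2 * ε / c * ‖F.mul p.2.2‖ := by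
  refine Lp.norm_le_mul_norm_of_ae_le_mul ?_
  filter_upwards [F.coeFn_mul p.1, F.coeFn_mul p.2.2, infDist_mul_norm_eq hε hp] with q h1 h2 h3
  rw [h1, h2, norm_smul, norm_smul]
  rcases le_total (Metric.infDist q Γ) c with hq | hq
  · simp [hF q hq]
  · rw [div_mul_eq_mul_div, le_div_iff₀ hc, mul_left_comm, ← h3, mul_assoc]
    refine mul_le_mul_of_nonneg_left ?_ (norm_nonneg _)
    rw [mul_comm]
    gcongr

theorem IsWeakSolution.norm_sq_le {V : C(Plane, ℝ)} {p : L2 × L2Field × L2} {η : L2}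
    (h : IsWeakSolution Ω V p η) : 1 / 2 * ‖p.2.1‖ ^ 2 + ‖p.2.2‖ ^ 2 ≤ ‖p.1‖ * ‖η‖ := by
  rw [← h.energy]
  exact re_inner_le_norm (𝕜 := ℂ) _ _

theorem hamiltonian_graph (ε : ℝ) (Γ : Set Plane) :
    (hamiltonian ε Γ).graph = schrodingerGraph Set.univ (constrainingPotential ε Γ) :=
  schrodinger_graph isOpen_univ (by simp)

theorem isOpen_infDist_ne (δ : ℝ) (Γ : Set Plane) : IsOpen {q | Metric.infDist q Γ ≠ δ} :=
  isOpen_ne_fun (Metric.continuous_infDist_pt Γ) continuous_const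

theorem volume_infDist_ne_compl (hΓ : Γ.Nonempty) (hδ : 0 < δ) :
    volume {q | Metric.infDist q Γ ≠ δ}ᶜ = 0 := by
  simpa [Set.compl_ofPred] using measure_infDist_eq Γ hΓ hδ

theorem dirichletHamiltonian_graph (hΓ : Γ.Nonempty) (hδ : 0 < δ) :
    (dirichletHamiltonian ε δ Γ).graph
      = schrodingerGraph {q | Metric.infDist q Γ ≠ δ} (constrainingPotential ε Γ) :=
  schrodinger_graph (isOpen_infDist_ne δ Γ) (volume_infDist_ne_compl hΓ hδ)

theorem isUnitaryGroupOf_hamiltonian (ε : ℝ) (Γ : Set Plane) :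
    IsUnitaryGroupOf (hamiltonian ε Γ) (evolution (hamiltonian ε Γ)) :=
  isUnitaryGroupOf_evolution isOpen_univ (by simp)

theorem isUnitaryGroupOf_dirichletHamiltonian (hΓ : Γ.Nonempty) (hδ : 0 < δ) :
    IsUnitaryGroupOf (dirichletHamiltonian ε δ Γ) (evolution (dirichletHamiltonian ε δ Γ)) :=
  isUnitaryGroupOf_evolution (isOpen_infDist_ne δ Γ) (volume_infDist_ne_compl hΓ hδ)

theorem IsSmoothedGraph.nonempty {ϑ : ℝ} {k : ℝ → ℝ} (h : IsSmoothedGraph ϑ k δ Γ) :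
    Γ.Nonempty := by
  obtain ⟨γ, -, rfl⟩ := h
  exact Set.range_nonempty γ

/-- The group commutes with its generator, so `‖Hψ‖ ≤ C/ε` persists and bounds the potential energy
by `C/ε` at every time; Chebyshev does the rest. -/
theorem norm_outsideTube_evolution_le (hε : 0 < ε) (hδ : 0 < δ) {C : ℝ}
    (ψ : (hamiltonian ε Γ).domain) (hψ : ‖(ψ : L2)‖ = 1) (hC : ‖hamiltonian ε Γ ψ‖ ≤ C / ε)
    (t : ℝ) : ‖outsideTube δ Γ (evolution (hamiltonian ε Γ) t ψ)‖
      ≤ (2 * C) ^ (1 / 2 : ℝ) * (ε ^ (1 / 2 : ℝ) / δ) := by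
  have hU := isUnitaryGroupOf_hamiltonian ε Γ
  have h1 := hU.mem_graph ((hamiltonian ε Γ).mem_graph ψ) t
  rw [hamiltonian_graph, mem_schrodingerGraph_iff] at h1
  obtain ⟨g, w, h1⟩ := h1
  have hC0 : 0 ≤ C := by
    have := (norm_nonneg _).trans hC
    by_contra! h
    exact absurd this (not_le.2 (div_neg_of_neg_of_pos h hε))
  have h2 : ‖w‖ ^ 2 ≤ C / ε := by
    have := h1.norm_sq_le
    simp only [hU.norm_apply, hψ, one_mul] at this
    nlinarith [sq_nonneg ‖g‖]
  have h3 := norm_outsideTube_le hε hδ h1.1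
  rw [← Real.sqrt_eq_rpow, ← Real.sqrt_eq_rpow]
  have h4 : ‖w‖ ≤ Real.sqrt (C / ε) := Real.le_sqrt_of_sq_le h2
  calc _ ≤ Real.sqrt 2 * ε / δ * ‖w‖ := h3
    _ ≤ Real.sqrt 2 * ε / δ * Real.sqrt (C / ε) := by gcongr
    _ = Real.sqrt (2 * C) * (Real.sqrt ε / δ) := by
        rw [Real.sqrt_mul zero_le_two, Real.sqrt_div hC0]
        have hs : Real.sqrt ε ≠ 0 := (Real.sqrt_pos.2 hε).ne'
        field_simp
        rw [Real.sq_sqrt hε.le, mul_comm]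

end

section

/-! ### Comparison with the Dirichlet evolution -/

variable {Ω : Set Plane} {V : C(Plane, ℝ)} {Γ : Set Plane} {ε δ D : ℝ}

/-- `F` vanishes near `Γ`, `X` vanishes away from the tube of radius `δ`, and `F = 1` where `X`
is not locally constant. -/
structure IsTubeCutoff (Γ : Set Plane) (δ : ℝ) (F X : Cutoff D) : Prop where
  eq_zero : ∀ q, Metric.infDist q Γ ≤ δ / 8 → F.toFun q = 0
  one_sub_le : ∀ q, 1 - X.toFun q ≤ F.toFun q
  grad : ∀ q, F.toFun q = 1 ∨ grad (fun q => (X.toFun q : ℂ)) q = 0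
  tsupport : tsupport X.toFun ⊆ {q | Metric.infDist q Γ < δ}

/-- `F` rises between distances `δ/8` and `δ/4`, and `X` falls between `δ/2` and `5δ/8`. The gap
makes `F = 1` wherever `∇X ≠ 0` and keeps the closed support of `X` inside the tube. -/
theorem exists_tubeCutoff : ∃ K : ℝ, 0 < K ∧ ∀ (Γ : Set Plane) (δ : ℝ), 0 < δ →
    ∃ F X : Cutoff (K / δ), IsTubeCutoff Γ δ F X := by
  obtain ⟨L, hL, h⟩ := exists_cutoff
  refine ⟨8 * L, by positivity, fun Γ δ hδ => ?_⟩
  have e : L / (δ / 8) = 8 * L / δ := by field_simp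
  rw [← e]
  obtain ⟨F, hF0, hF1, -⟩ := h Γ (δ / 8) (δ / 8) (by positivity)
  obtain ⟨Y, hY0, hY1, hYg⟩ := h Γ (δ / 2) (δ / 8) (by positivity)
  refine ⟨F, Y.compl, hF0, fun q => ?_, fun q => ?_, fun q hq => ?_⟩
  · change 1 - (1 - Y.toFun q) ≤ F.toFun q
    rcases le_total (Metric.infDist q Γ) (δ / 2) with hq | hq
    · rw [hY0 q hq]
      simpa using F.nonneg q
    · rw [hF1 q (by linarith)]
      linarith [Y.le_one q]
  · rcases lt_or_ge (Metric.infDist q Γ) (δ / 2) with hq | hq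
    · right
      rw [Cutoff.compl, Y.grad_compl, hYg q hq, neg_zero]
    · left
      exact hF1 q (by linarith)
  · have hc : IsClosed {q | Metric.infDist q Γ ≤ δ / 2 + δ / 8} :=
      isClosed_le (Metric.continuous_infDist_pt Γ) continuous_const
    have hs : Function.support Y.compl.toFun ⊆ {q | Metric.infDist q Γ ≤ δ / 2 + δ / 8} := by
      intro x hx
      by_contra hx'
      rw [Set.mem_ofPred_eq, not_le] at hx'
      refine hx ?_
      change 1 - Y.toFun x = 0
      rw [hY1 x hx'.le, sub_self]
    have := closure_minimal hs hc hq
    rw [Set.mem_ofPred_eq] at this ⊢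
    linarith

/-- Away from `Γ`, vectors in the domain are small and their gradients are controlled. -/
theorem IsWeakSolution.cutoff_bounds (hε : 0 < ε) (hδ : 0 < δ) {K C : ℝ} (hK : 0 < K)
    (hC : 0 ≤ C) {p : L2 × L2Field × L2} {η : L2}
    (h : IsWeakSolution Ω (constrainingPotential ε Γ) p η) (hp : ‖p.1‖ = 1)
    (hη : ‖η‖ ≤ C / ε) (F : Cutoff (K / δ))
    (hF : ∀ q, Metric.infDist q Γ ≤ δ / 8 → F.toFun q = 0) :
    ‖F.mul p.1‖ ≤ (128 * C + 12 * K) * ε / δ ^ 2 ∧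
      ‖F.mul p.2.1‖ ≤ 2 * Real.sqrt ((128 * C + 12 * K) * C + K ^ 2) / δ := by
  set M := 128 * C + 12 * K with hM
  have h1 := h.localized_energy F
  have h2 : ‖F.gradMul p.1‖ ≤ K / δ := by
    have := F.norm_gradMul_le p.1
    rwa [hp, mul_one] at this
  have h3 : ‖F.mul η‖ ≤ C / ε := (F.norm_mul_le η).trans hη
  have h4 := norm_cutoff_mul_le hε (by positivity) F hF h.1
  set x := ‖F.mul p.1‖
  have hx : 0 ≤ x := norm_nonneg _
  have h5 : 1 / 4 * ‖F.mul p.2.1‖ ^ 2 + ‖F.mul p.2.2‖ ^ 2 ≤ x * (C / ε) + (K / δ) ^ 2 := by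
    refine h1.trans ?_
    gcongr
  have h6 : x ^ 2 ≤ 128 * ε ^ 2 / δ ^ 2 * ‖F.mul p.2.2‖ ^ 2 := by
    refine (pow_le_pow_left₀ hx h4 2).trans (le_of_eq ?_)
    rw [mul_pow, div_pow, mul_pow, Real.sq_sqrt zero_le_two]
    field_simp
    ring
  have h7 : x ^ 2 ≤ 128 * ε ^ 2 / δ ^ 2 * (x * (C / ε) + (K / δ) ^ 2) := by
    refine h6.trans (mul_le_mul_of_nonneg_left ?_ (by positivity))
    nlinarith [sq_nonneg ‖F.mul p.2.1‖]
  have hM0 : 0 < M := by positivity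
  have h8 : x ≤ M * ε / δ ^ 2 := by
    -- In units of `ε/δ²` all powers of `ε` and `δ` cancel, leaving `y² ≤ 128 C y + 128 K²`. If `y >
    -- M`, then `y (y - 128 C) > 144 K²`, a contradiction.
    obtain ⟨y, hy⟩ : ∃ y, x = y * ε / δ ^ 2 := ⟨x * δ ^ 2 / ε, by field_simp⟩
    have h9 : y ^ 2 ≤ 128 * C * y + 128 * K ^ 2 := by
      rw [hy] at h7
      have e1 : (y * ε / δ ^ 2) ^ 2 = y ^ 2 * (ε ^ 2 / δ ^ 4) := by field_simp
      have e2 : 128 * ε ^ 2 / δ ^ 2 * (y * ε / δ ^ 2 * (C / ε) + (K / δ) ^ 2)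
          = (128 * C * y + 128 * K ^ 2) * (ε ^ 2 / δ ^ 4) := by field_simp
      rw [e1, e2] at h7
      exact le_of_mul_le_mul_right h7 (by positivity)
    rw [hy]
    gcongr
    by_contra! hc
    nlinarith [mul_pos hM0 hK, mul_nonneg hC hK.le]
  refine ⟨h8, ?_⟩
  have h9 : ‖F.mul p.2.1‖ ^ 2 ≤ 4 * (M * C + K ^ 2) / δ ^ 2 := by
    have e : x * (C / ε) ≤ M * C / δ ^ 2 := by
      calc x * (C / ε) ≤ M * ε / δ ^ 2 * (C / ε) := by gcongr
        _ = _ := by field_simp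
    have e2 : 4 * (M * C + K ^ 2) / δ ^ 2 = 4 * (M * C / δ ^ 2 + (K / δ) ^ 2) := by
      field_simp
    rw [e2]
    nlinarith [sq_nonneg ‖F.mul p.2.2‖]
  refine abs_le_of_sq_le_sq' ?_ (by positivity) |>.2
  refine h9.trans (le_of_eq ?_)
  rw [div_pow, mul_pow, Real.sq_sqrt (by positivity)]
  norm_num

theorem norm_gradMul_le_norm_mul {F X : Cutoff D} (h : IsTubeCutoff Γ δ F X) (ψ : L2) :
    ‖X.gradMul ψ‖ ≤ D * ‖F.mul ψ‖ := by
  refine Lp.norm_le_mul_norm_of_ae_le_mul ?_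
  filter_upwards [X.coeFn_gradMul ψ, F.coeFn_mul ψ] with q h1 h2
  have hD : 0 ≤ D := (norm_nonneg _).trans (F.grad_le q)
  rw [h1, h2, norm_smul, norm_smul]
  rcases h.grad q with hq | hq
  · rw [hq, Complex.ofReal_one, norm_one, one_mul, mul_comm]
    exact mul_le_mul_of_nonneg_right (X.grad_le q) (norm_nonneg _)
  · rw [hq, norm_zero, mul_zero]
    positivity

theorem mul_gradMul {F X : Cutoff D} (h : IsTubeCutoff Γ δ F X) (ψ : L2) :
    F.mul (X.gradMul ψ) = X.gradMul ψ := by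
  refine Lp.ext ?_
  filter_upwards [X.coeFn_gradMul ψ, F.coeFn_mul (X.gradMul ψ)] with q h1 h2
  rw [h2, h1]
  rcases h.grad q with hq | hq
  · rw [hq, Complex.ofReal_one, one_smul]
  · rw [hq, smul_zero, smul_zero]

theorem norm_sub_mul_le {F X : Cutoff D} (h : IsTubeCutoff Γ δ F X) (ψ : L2) :
    ‖ψ - X.mul ψ‖ ≤ ‖F.mul ψ‖ := by
  rw [← X.compl_mul]
  refine Lp.norm_le_norm_of_ae_le ?_
  filter_upwards [X.compl.coeFn_mul ψ, F.coeFn_mul ψ] with q h1 h2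
  rw [h1, h2, norm_smul, norm_smul, Complex.norm_real, Complex.norm_real,
    Real.norm_of_nonneg (X.compl.nonneg q), Real.norm_of_nonneg (F.nonneg q)]
  exact mul_le_mul_of_nonneg_right (h.one_sub_le q) (norm_nonneg _)

theorem norm_insideTube_sub_mul_le {F X : Cutoff D} (h : IsTubeCutoff Γ δ F X) (ψ : L2) :
    ‖insideTube δ Γ ψ - X.mul ψ‖ ≤ ‖F.mul ψ‖ := by
  refine Lp.norm_le_norm_of_ae_le ?_
  have h1 : insideTube δ Γ ψ =ᵐ[volume] {q | Metric.infDist q Γ < δ}.indicator ψ :=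
    coeFn_cutoff _ _
  filter_upwards [h1, X.coeFn_mul ψ, F.coeFn_mul ψ, Lp.coeFn_sub (insideTube δ Γ ψ) (X.mul ψ)]
    with q h1 h2 h3 h4
  rw [h4, Pi.sub_apply, h1, h2, h3]
  by_cases hq : Metric.infDist q Γ < δ
  · rw [Set.indicator_of_mem (show q ∈ {q | Metric.infDist q Γ < δ} from hq)]
    have e : ψ q - (X.toFun q : ℂ) • ψ q = ((1 - X.toFun q : ℝ) : ℂ) • ψ q := by
      push_cast
      rw [sub_smul, one_smul]
    rw [e, norm_smul, norm_smul, Complex.norm_real, Complex.norm_real,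
      Real.norm_of_nonneg (sub_nonneg.2 (X.le_one q)), Real.norm_of_nonneg (F.nonneg q)]
    exact mul_le_mul_of_nonneg_right (h.one_sub_le q) (norm_nonneg _)
  · have hX : X.toFun q = 0 := image_eq_zero_of_notMem_tsupport fun hq' => hq (h.tsupport hq')
    rw [Set.indicator_of_notMem (show q ∉ {q | Metric.infDist q Γ < δ} from hq), hX]
    simp only [Complex.ofReal_zero, zero_smul, sub_zero, norm_zero]
    positivity

theorem tubeCutoff_mul_mem_formDomain {F X : Cutoff D} (h : IsTubeCutoff Γ δ F X)
    {p : L2 × L2Field × L2} (hp : p ∈ formDomain Set.univ V) :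
    (X.mul p.1, X.mul p.2.1 + X.gradMul p.1, X.mul p.2.2)
      ∈ formDomain {q | Metric.infDist q Γ ≠ δ} V :=
  formDomain_mul X (fun _ hq => (h.tsupport hq.1).ne) hp

/-- The commutator of the Hamiltonian with a cutoff function is supported where the cutoff
function is not locally constant. -/
theorem norm_inner_commutator_le {F X : Cutoff D} (h : IsTubeCutoff Γ δ F X)
    {p k : L2 × L2Field × L2} {η κ : L2} (hp : IsWeakSolution Set.univ V p η)
    (hk : IsWeakSolution {q | Metric.infDist q Γ ≠ δ} V k κ) :
    ‖⟪κ, X.mul p.1⟫_ℂ - ⟪k.1, X.mul η⟫_ℂ‖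
      ≤ 1 / 2 * (‖k.2.1‖ * (D * ‖F.mul p.1‖) + D * ‖F.mul k.1‖ * ‖F.mul p.2.1‖) := by
  -- Test the Dirichlet equation with `Xψ` and the free equation with `Xk`. The terms without `∇X`
  -- agree and cancel; in the others `F` can be inserted, as it is 1 on the support of `∇X`.
  have h1 := congrArg (starRingEnd ℂ) (hk.2 _ (tubeCutoff_mul_mem_formDomain h hp.1))
  have h2 := hp.2 _ (formDomain_mul X (Set.subset_univ _) hk.1)
  simp only [map_add, map_mul, inner_conj_symm, map_div₀, map_one, Complex.conj_ofNat,
    inner_add_right] at h1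
  simp only [inner_add_left, X.inner_mul] at h2
  have e : ⟪κ, X.mul p.1⟫_ℂ - ⟪k.1, X.mul η⟫_ℂ
      = 1 / 2 * (⟪k.2.1, X.gradMul p.1⟫_ℂ - ⟪X.gradMul k.1, F.mul p.2.1⟫_ℂ) := by
    rw [← h1, ← h2, ← F.inner_mul, mul_gradMul h]
    ring
  rw [e, norm_mul]
  have e2 : ‖(1 / 2 : ℂ)‖ = 1 / 2 := by simp
  rw [e2]
  refine mul_le_mul_of_nonneg_left ((norm_sub_le _ _).trans (add_le_add ?_ ?_)) (by norm_num)
  · exact (norm_inner_le_norm _ _).trans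
      (mul_le_mul_of_nonneg_left (norm_gradMul_le_norm_mul h _) (norm_nonneg _))
  · exact (norm_inner_le_norm _ _).trans
      (mul_le_mul_of_nonneg_right (norm_gradMul_le_norm_mul h _) (norm_nonneg _))

/-- Resolvents do not increase the energy. -/
theorem IsResolvent.exists_weakSolution {l : ℝ} (hl : 0 < l) {J : L2 →L[ℂ] L2}
    (hJ : IsResolvent (schrodingerGraph Ω V) l J) {ξ : L2 × L2Field × L2}
    (hξ : ξ ∈ formDomain Ω V) :
    ∃ k κ, IsWeakSolution Ω V k κ ∧ k.1 = J ξ.1 ∧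
      1 / 2 * ‖k.2.1‖ ^ 2 + ‖k.2.2‖ ^ 2 ≤ 1 / 2 * ‖ξ.2.1‖ ^ 2 + ‖ξ.2.2‖ ^ 2 := by
  obtain ⟨g, w, h⟩ := mem_schrodingerGraph_iff.1 (hJ.yosida_mem ξ.1)
  refine ⟨_, _, h, rfl, ?_⟩
  set κ := yosida l J ξ.1
  have h1 := h.energy
  have h2 := congrArg Complex.re (h.2 ξ hξ)
  -- As `ξ = k + lκ` with `κ = A k`, the form at `(ξ, k)` equals the energy of `k` plus `l ‖κ‖²`;
  -- Cauchy–Schwarz for the form then compares energies.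
  have h3 : (⟪ξ.1, κ⟫_ℂ).re = (⟪J ξ.1, κ⟫_ℂ).re + l * ‖κ‖ ^ 2 := by
    have h4 : (⟪κ, κ⟫_ℂ).re = ‖κ‖ ^ 2 := inner_self_eq_norm_sq (𝕜 := ℂ) _
    nth_rw 1 [← IsResolvent.add_yosida (J := J) hl ξ.1]
    rw [inner_add_left, inner_smul_left, Complex.conj_ofReal, Complex.add_re,
      Complex.re_ofReal_mul, h4]
  have h4 : (⟪ξ.2.1, g⟫_ℂ).re ≤ ‖ξ.2.1‖ * ‖g‖ := re_inner_le_norm (𝕜 := ℂ) _ _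
  have h5 : (⟪ξ.2.2, w⟫_ℂ).re ≤ ‖ξ.2.2‖ * ‖w‖ := re_inner_le_norm (𝕜 := ℂ) _ _
  rw [Complex.add_re, show (1 / 2 : ℂ) = ((1 / 2 : ℝ) : ℂ) by simp, Complex.re_ofReal_mul, h3,
    h1] at h2
  simp only at h2 ⊢
  nlinarith [sq_nonneg (‖ξ.2.1‖ - ‖g‖), sq_nonneg (‖ξ.2.2‖ - ‖w‖),
    mul_nonneg hl.le (sq_nonneg ‖κ‖)]

end

/-! ### The time-dependent estimate. -/

section

variable {Γ : Set Plane} {ε δ : ℝ}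

/-- Here `s = √ε` and `k` has Dirichlet energy at most `(e/s)²`. The derivative of the overlap is a
commutator with two terms: `‖∇k‖ · ‖ψ∇X‖` is of order `s⁻¹ · s²/δ³`, and `‖k∇X‖ · ‖F∇ψ‖` of order
`s/δ² · δ⁻¹`. Both are `s/δ³`. -/
theorem norm_inner_evolution_sub_le (hΓ : Γ.Nonempty) (hδ : 0 < δ) {s : ℝ} (hs : 0 < s)
    {K C e : ℝ} (hK : 0 < K) (hC : 0 ≤ C) (he : 0 ≤ e) {F X : Cutoff (K / δ)}
    (h : IsTubeCutoff Γ δ F X) {ψ η : L2} (hψ : ‖ψ‖ = 1) (hη : ‖η‖ ≤ C / s ^ 2)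
    (hg : (ψ, η) ∈ (hamiltonian (s ^ 2) Γ).graph) {k : L2 × L2Field × L2} {κ : L2}
    (hk : IsWeakSolution {q | Metric.infDist q Γ ≠ δ} (constrainingPotential (s ^ 2) Γ) k κ)
    (hke : 1 / 2 * ‖k.2.1‖ ^ 2 + ‖k.2.2‖ ^ 2 ≤ (e / s) ^ 2) {t : ℝ} (ht : 0 ≤ t) :
    ‖⟪evolution (dirichletHamiltonian (s ^ 2) δ Γ) t k.1,
        X.mul (evolution (hamiltonian (s ^ 2) Γ) t ψ)⟫_ℂ - ⟪k.1, X.mul ψ⟫_ℂ‖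
      ≤ e * K * (128 * C + 12 * K + 16 * Real.sqrt ((128 * C + 12 * K) * C + K ^ 2))
        * s / δ ^ 3 * t := by
  have hε : 0 < s ^ 2 := by positivity
  have hU := isUnitaryGroupOf_hamiltonian (s ^ 2) Γ
  have hW := isUnitaryGroupOf_dirichletHamiltonian (ε := s ^ 2) hΓ hδ
  have hgr := dirichletHamiltonian_graph (ε := s ^ 2) hΓ hδ
  have hkg : (k.1, κ) ∈ (dirichletHamiltonian (s ^ 2) δ Γ).graph := by
    rw [hgr, mem_schrodingerGraph_iff]
    exact ⟨k.2.1, k.2.2, hk⟩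
  set U := evolution (hamiltonian (s ^ 2) Γ)
  set W := evolution (dirichletHamiltonian (s ^ 2) δ Γ)
  set M := 128 * C + 12 * K with hM
  set N := Real.sqrt (M * C + K ^ 2)
  have hN : 0 ≤ N := Real.sqrt_nonneg _
  have hM0 : 0 < M := by positivity
  have hd : ∀ r, HasDerivAt (fun r => ⟪W r k.1, X.mul (U r ψ)⟫_ℂ)
      (Complex.I * (⟪W r κ, X.mul (U r ψ)⟫_ℂ - ⟪W r k.1, X.mul (U r η)⟫_ℂ)) r := by
    intro r
    have h1 := hW.hasDerivAt hkg r
    have h2 := (X.mul.restrictScalars ℝ).hasFDerivAt.comp_hasDerivAt r (hU.hasDerivAt hg r)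
    have h3 := h1.inner ℂ h2
    refine h3.congr_deriv ?_
    simp only [Function.comp_apply, ContinuousLinearMap.coe_restrictScalars', map_neg, map_smul,
      inner_neg_left, inner_neg_right, inner_smul_left, inner_smul_right, Complex.conj_I]
    ring
  have hb : ∀ r, ‖Complex.I * (⟪W r κ, X.mul (U r ψ)⟫_ℂ - ⟪W r k.1, X.mul (U r η)⟫_ℂ)‖
      ≤ e * K * (M + 16 * N) * s / δ ^ 3 := by
    intro r
    rw [norm_mul, Complex.norm_I, one_mul]
    have h1 := hU.mem_graph hg r
    rw [hamiltonian_graph, mem_schrodingerGraph_iff] at h1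
    obtain ⟨g, w, h1⟩ := h1
    have h2 := hW.mem_graph hkg r
    rw [hgr, mem_schrodingerGraph_iff] at h2
    obtain ⟨g', w', h2⟩ := h2
    have h3 := norm_inner_commutator_le h h1 h2
    simp only at h3
    obtain ⟨h4, h5⟩ := h1.cutoff_bounds hε hδ hK hC (by rw [hU.norm_apply, hψ])
      (by rw [hU.norm_apply]; exact hη) F h.eq_zero
    simp only at h4 h5
    -- The Dirichlet energy is conserved by the Dirichlet evolution.
    have h6 : 1 / 2 * ‖g'‖ ^ 2 + ‖w'‖ ^ 2 ≤ (e / s) ^ 2 := by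
      have e1 := h2.energy
      have e2 := hk.energy
      simp only [hW.inner_apply] at e1
      rw [e2] at e1
      rw [← e1]
      exact hke
    have hes : 0 ≤ e / s := by positivity
    have h7 : ‖g'‖ ≤ 2 * (e / s) :=
      (abs_le_of_sq_le_sq' (by nlinarith [sq_nonneg ‖w'‖, sq_nonneg (e / s)])
        (by positivity)).2
    have h8 : ‖w'‖ ≤ e / s :=
      (abs_le_of_sq_le_sq' (by nlinarith [sq_nonneg ‖g'‖]) hes).2
    have h9 : ‖F.mul (W r k.1)‖ ≤ 16 * e * s / δ := by
      have h10 := norm_cutoff_mul_le hε (by positivity) F h.eq_zero h2.1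
      simp only at h10
      have h11 : Real.sqrt 2 ≤ 2 := by
        rw [Real.sqrt_le_left zero_le_two]
        norm_num
      calc _ ≤ Real.sqrt 2 * s ^ 2 / (δ / 8) * ‖F.mul w'‖ := h10
        _ ≤ 2 * s ^ 2 / (δ / 8) * (e / s) := by
            gcongr
            exact (F.norm_mul_le w').trans h8
        _ = 16 * e * s / δ := by field_simp; ring
    calc _ ≤ _ := h3
      _ ≤ 1 / 2 * (2 * (e / s) * (K / δ * (M * s ^ 2 / δ ^ 2))
          + K / δ * (16 * e * s / δ) * (2 * N / δ)) := by gcongr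
      _ = _ := by field_simp
  have := norm_image_sub_le_of_norm_deriv_le_segment' (a := 0) (b := t)
    (fun r _ => (hd r).hasDerivWithinAt) (fun r _ => hb r) t (Set.right_mem_Icc.2 ht)
  simpa only [hU.map_zero, hW.map_zero, one_apply_eq_self, sub_zero] using this

/-- Expand the square; the cross term is known from its value at time zero, `‖Xψ‖²`, up to the
overlap error. -/
theorem norm_mul_evolution_sub_sq_le (hΓ : Γ.Nonempty) (hδ : 0 < δ) {s : ℝ} (hs : 0 < s)
    (hsδ : s ≤ δ) {K C : ℝ} (hK : 0 < K) (hC : 0 ≤ C) {F X : Cutoff (K / δ)}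
    (h : IsTubeCutoff Γ δ F X) {ψ η : L2} (hψ : ‖ψ‖ = 1) (hη : ‖η‖ ≤ C / s ^ 2)
    (hg : (ψ, η) ∈ (hamiltonian (s ^ 2) Γ).graph) {t : ℝ} (ht : 0 ≤ t) :
    ‖X.mul (evolution (hamiltonian (s ^ 2) Γ) t ψ)
        - evolution (dirichletHamiltonian (s ^ 2) δ Γ) t (X.mul ψ)‖ ^ 2
      ≤ 2 * (128 * C + 12 * K) * s ^ 2 / δ ^ 2 + 2 * (Real.sqrt (2 * C + K ^ 2) * K *
        (128 * C + 12 * K + 16 * Real.sqrt ((128 * C + 12 * K) * C + K ^ 2)) * s / δ ^ 3 * t) := by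
  have hε : 0 < s ^ 2 := by positivity
  have hU := isUnitaryGroupOf_hamiltonian (s ^ 2) Γ
  have hW := isUnitaryGroupOf_dirichletHamiltonian (ε := s ^ 2) hΓ hδ
  set e := Real.sqrt (2 * C + K ^ 2)
  set B := e * K * (128 * C + 12 * K + 16 * Real.sqrt ((128 * C + 12 * K) * C + K ^ 2))
    * s / δ ^ 3 * t with hB
  obtain ⟨g, w, hp⟩ := mem_schrodingerGraph_iff.1 ((hamiltonian_graph (s ^ 2) Γ) ▸ hg)
  have hF := (hp.cutoff_bounds hε hδ hK hC hψ hη F h.eq_zero).1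
  have hX1 : 1 - ‖X.mul ψ‖ ≤ (128 * C + 12 * K) * s ^ 2 / δ ^ 2 := by
    have h1 := (norm_sub_norm_le ψ (X.mul ψ)).trans (norm_sub_mul_le h ψ)
    rw [hψ] at h1
    exact h1.trans hF
  have hX2 : ‖X.mul ψ‖ ≤ 1 := (X.norm_mul_le ψ).trans hψ.le
  have hX3 : ‖X.mul (evolution (hamiltonian (s ^ 2) Γ) t ψ)‖ ≤ 1 :=
    (X.norm_mul_le _).trans (by rw [hU.norm_apply, hψ])
  have hξ := tubeCutoff_mul_mem_formDomain h hp.1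
  have hξe : 1 / 2 * ‖X.mul g + X.gradMul ψ‖ ^ 2 + ‖X.mul w‖ ^ 2 ≤ (e / s) ^ 2 := by
    have h1 := hp.norm_sq_le
    simp only [hψ, one_mul] at h1
    have h2 : ‖X.gradMul ψ‖ ≤ K / δ := by
      have := X.norm_gradMul_le ψ
      rwa [hψ, mul_one] at this
    -- Because `s ≤ δ`, the kinetic energy created by the cutoff is of the order `1/ε` already
    -- present, so `Xψ` has energy at most `(2C + K²)/s²`.
    have h3 : K / δ ≤ K / s := by gcongr
    have h4 : ‖X.mul g + X.gradMul ψ‖ ≤ ‖g‖ + K / s :=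
      (norm_add_le _ _).trans (add_le_add (X.norm_mul_le g) (h2.trans h3))
    have h5 := pow_le_pow_left₀ (norm_nonneg _) h4 2
    have h6 := pow_le_pow_left₀ (norm_nonneg _) (X.norm_mul_le w) 2
    have h7 : (e / s) ^ 2 = 2 * (C / s ^ 2) + (K / s) ^ 2 := by
      rw [div_pow, Real.sq_sqrt (by positivity)]
      field_simp
    rw [h7]
    nlinarith [sq_nonneg (‖g‖ - K / s), sq_nonneg ‖w‖]
  have key : ‖⟪evolution (dirichletHamiltonian (s ^ 2) δ Γ) t (X.mul ψ),
      X.mul (evolution (hamiltonian (s ^ 2) Γ) t ψ)⟫_ℂ - ⟪X.mul ψ, X.mul ψ⟫_ℂ‖ ≤ B := by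
    -- At this point `Xψ` is known only to lie in the Dirichlet form domain. Resolvents move it into
    -- the operator domain without raising its energy, so the bound is uniform and passes to the
    -- limit.
    have hG := isNonnegSelfAdjoint_schrodingerGraph (V := constrainingPotential (s ^ 2) Γ)
      (isOpen_infDist_ne δ Γ) (volume_infDist_ne_compl hΓ hδ)
    let l : ℕ → ℝ := fun n => 1 / ((n : ℝ) + 1)
    have hl : ∀ n, 0 < l n := fun n => by positivity
    choose J hJ using fun n => hG.exists_resolvent (hl n)
    have hJt := IsResolvent.tendsto hG hl tendsto_one_div_add_atTop_nhds_zero_nat hJ (X.mul ψ)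
    have hlim : Tendsto (fun n => ‖⟪evolution (dirichletHamiltonian (s ^ 2) δ Γ) t
        (J n (X.mul ψ)), X.mul (evolution (hamiltonian (s ^ 2) Γ) t ψ)⟫_ℂ
        - ⟪J n (X.mul ψ), X.mul ψ⟫_ℂ‖) atTop
        (𝓝 ‖⟪evolution (dirichletHamiltonian (s ^ 2) δ Γ) t (X.mul ψ),
        X.mul (evolution (hamiltonian (s ^ 2) Γ) t ψ)⟫_ℂ - ⟪X.mul ψ, X.mul ψ⟫_ℂ‖) := by
      have h1 := ((evolution (dirichletHamiltonian (s ^ 2) δ Γ) t).continuous.tendsto _).comp hJt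
      exact ((h1.inner tendsto_const_nhds).sub (hJt.inner tendsto_const_nhds)).norm
    refine le_of_tendsto' hlim fun n => ?_
    obtain ⟨k, κ, hk, hk1, hke⟩ := (hJ n).exists_weakSolution (hl n) hξ
    simp only at hk1 hke
    rw [← hk1]
    exact norm_inner_evolution_sub_le hΓ hδ hs hK hC (Real.sqrt_nonneg _) h hψ hη hg hk
      (hke.trans hξe) ht
  have h1 : ‖X.mul ψ‖ ^ 2 - B ≤ (⟪evolution (dirichletHamiltonian (s ^ 2) δ Γ) t (X.mul ψ),
      X.mul (evolution (hamiltonian (s ^ 2) Γ) t ψ)⟫_ℂ).re := by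
    have h2 := (abs_le.1 ((Complex.abs_re_le_norm _).trans key)).1
    have h3 : (⟪X.mul ψ, X.mul ψ⟫_ℂ).re = ‖X.mul ψ‖ ^ 2 := inner_self_eq_norm_sq (𝕜 := ℂ) _
    rw [Complex.sub_re, h3] at h2
    linarith
  have h2 := norm_sub_sq (𝕜 := ℂ) (evolution (dirichletHamiltonian (s ^ 2) δ Γ) t (X.mul ψ))
    (X.mul (evolution (hamiltonian (s ^ 2) Γ) t ψ))
  rw [norm_sub_rev, h2, hW.norm_apply]
  change _ - 2 * (⟪evolution (dirichletHamiltonian (s ^ 2) δ Γ) t (X.mul ψ),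
      X.mul (evolution (hamiltonian (s ^ 2) Γ) t ψ)⟫_ℂ).re + _ ≤ _
  have h3 : 2 * (128 * C + 12 * K) * s ^ 2 / δ ^ 2 = 2 * ((128 * C + 12 * K) * s ^ 2 / δ ^ 2) := by
    ring
  rw [h3]
  -- The square is at most `1 + ‖Xψ‖² - 2(‖Xψ‖² - B) = (1 - ‖Xψ‖)(1 + ‖Xψ‖) + 2B ≤ 2(1 - ‖Xψ‖) +
  -- 2B`.
  nlinarith [norm_nonneg (X.mul ψ), norm_nonneg (X.mul (evolution (hamiltonian (s ^ 2) Γ) t ψ))]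

/-- With `r = ε^(1/4)` and `u = δ^(1/2)` all exponents are integers. The errors are `ε/δ²` (sharp
against smooth cutoff, at times `0` and `t`), `ε^(1/2)/δ` and `ε^(1/4)/δ^(3/2)`; for `r ≤ u ≤ 1`
each is at most `r/u^5 = ε^(1/4)/δ^(5/2)`. -/
theorem norm_insideTube_evolution_sub_le (hΓ : Γ.Nonempty) {r u : ℝ} (hr : 0 < r) (hu : 0 < u)
    (hru : r ≤ u) (hu1 : u ≤ 1) {K C : ℝ} (hK : 0 < K) (hC : 0 ≤ C) {F X : Cutoff (K / u ^ 2)}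
    (h : IsTubeCutoff Γ (u ^ 2) F X) {ψ η : L2} (hψ : ‖ψ‖ = 1) (hη : ‖η‖ ≤ C / r ^ 4)
    (hg : (ψ, η) ∈ (hamiltonian (r ^ 4) Γ).graph) {t : ℝ} (ht : 0 ≤ t) :
    ‖insideTube (u ^ 2) Γ (evolution (hamiltonian (r ^ 4) Γ) t ψ)
        - evolution (dirichletHamiltonian (r ^ 4) (u ^ 2) Γ) t (insideTube (u ^ 2) Γ ψ)‖
      ≤ (2 * (128 * C + 12 * K) + Real.sqrt (2 * (128 * C + 12 * K) +
        2 * (Real.sqrt (2 * C + K ^ 2) * K * (128 * C + 12 * K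
          + 16 * Real.sqrt ((128 * C + 12 * K) * C + K ^ 2)) * t))) * (r / u ^ 5) := by
  have hδ : 0 < u ^ 2 := by positivity
  have hε : 0 < r ^ 4 := by positivity
  have e4 : r ^ 4 = (r ^ 2) ^ 2 := by ring
  have hU := isUnitaryGroupOf_hamiltonian (r ^ 4) Γ
  have hW := isUnitaryGroupOf_dirichletHamiltonian (ε := r ^ 4) hΓ hδ
  have hgt := hU.mem_graph hg t
  have hF : ∀ {ψ η : L2}, (ψ, η) ∈ (hamiltonian (r ^ 4) Γ).graph → ‖ψ‖ = 1 → ‖η‖ ≤ C / r ^ 4 →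
      ‖F.mul ψ‖ ≤ (128 * C + 12 * K) * r ^ 4 / (u ^ 2) ^ 2 := by
    intro ψ η hg hψ hη
    obtain ⟨g, w, hp⟩ := mem_schrodingerGraph_iff.1 ((hamiltonian_graph (r ^ 4) Γ) ▸ hg)
    exact (hp.cutoff_bounds hε hδ hK hC hψ hη F h.eq_zero).1
  have h1 := (norm_insideTube_sub_mul_le h _).trans
    (hF hgt (by rw [hU.norm_apply, hψ]) (by rw [hU.norm_apply]; exact hη))
  have h2 := (norm_insideTube_sub_mul_le h _).trans (hF hg hψ hη)
  have h3 : ‖X.mul (evolution (hamiltonian (r ^ 4) Γ) t ψ)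
        - evolution (dirichletHamiltonian (r ^ 4) (u ^ 2) Γ) t (X.mul ψ)‖ ^ 2
      ≤ 2 * (128 * C + 12 * K) * (r ^ 2) ^ 2 / (u ^ 2) ^ 2 + 2 * (Real.sqrt (2 * C + K ^ 2) * K *
        (128 * C + 12 * K + 16 * Real.sqrt ((128 * C + 12 * K) * C + K ^ 2)) * r ^ 2
          / (u ^ 2) ^ 3 * t) := by
    rw [e4] at hg hη ⊢
    exact norm_mul_evolution_sub_sq_le hΓ hδ (by positivity) (pow_le_pow_left₀ hr.le hru 2) hK hC
      h hψ hη hg ht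
  set M := 128 * C + 12 * K with hM
  set P := Real.sqrt (2 * C + K ^ 2) * K * (M + 16 * Real.sqrt (M * C + K ^ 2)) with hP
  have hM0 : 0 ≤ M := by positivity
  have hP0 : 0 ≤ P := by positivity
  have hr1 : r ≤ 1 := hru.trans hu1
  have b1 : r ^ 4 / (u ^ 2) ^ 2 ≤ r / u ^ 5 := by
    rw [div_le_div_iff₀ (by positivity) (by positivity)]
    have : r ^ 3 * u ≤ 1 := mul_le_one₀ (pow_le_one₀ hr.le hr1) hu.le hu1
    calc r ^ 4 * u ^ 5 = (r * u ^ 4) * (r ^ 3 * u) := by ring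
      _ ≤ (r * u ^ 4) * 1 := by gcongr
      _ = _ := by ring
  have b2 : (r ^ 2) ^ 2 / (u ^ 2) ^ 2 ≤ (r / u ^ 5) ^ 2 := by
    rw [div_pow, div_le_div_iff₀ (by positivity) (by positivity)]
    have : r ^ 2 * u ^ 6 ≤ 1 :=
      mul_le_one₀ (pow_le_one₀ hr.le hr1) (by positivity) (pow_le_one₀ hu.le hu1)
    calc (r ^ 2) ^ 2 * (u ^ 5) ^ 2 = (r ^ 2 * u ^ 4) * (r ^ 2 * u ^ 6) := by ring
      _ ≤ (r ^ 2 * u ^ 4) * 1 := by gcongr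
      _ = _ := by ring
  have b3 : r ^ 2 / (u ^ 2) ^ 3 ≤ (r / u ^ 5) ^ 2 := by
    rw [div_pow, div_le_div_iff₀ (by positivity) (by positivity)]
    have : u ^ 4 ≤ 1 := pow_le_one₀ hu.le hu1
    calc r ^ 2 * (u ^ 5) ^ 2 = (r ^ 2 * u ^ 6) * u ^ 4 := by ring
      _ ≤ (r ^ 2 * u ^ 6) * 1 := by gcongr
      _ = _ := by ring
  have h4 : ‖X.mul (evolution (hamiltonian (r ^ 4) Γ) t ψ)
        - evolution (dirichletHamiltonian (r ^ 4) (u ^ 2) Γ) t (X.mul ψ)‖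
      ≤ Real.sqrt (2 * M + 2 * (P * t)) * (r / u ^ 5) := by
    refine (abs_le_of_sq_le_sq' ?_ (by positivity)).2
    rw [mul_pow, Real.sq_sqrt (by positivity)]
    refine h3.trans ?_
    calc 2 * M * (r ^ 2) ^ 2 / (u ^ 2) ^ 2 + 2 * (P * r ^ 2 / (u ^ 2) ^ 3 * t)
        = 2 * M * ((r ^ 2) ^ 2 / (u ^ 2) ^ 2) + 2 * (P * t) * (r ^ 2 / (u ^ 2) ^ 3) := by ring
      _ ≤ 2 * M * (r / u ^ 5) ^ 2 + 2 * (P * t) * (r / u ^ 5) ^ 2 := by gcongr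
      _ = _ := by ring
  have h5 : ∀ {x : ℝ}, x ≤ M * r ^ 4 / (u ^ 2) ^ 2 → x ≤ M * (r / u ^ 5) := fun hx =>
    hx.trans (by rw [mul_div_assoc]; gcongr)
  have h6 : ‖evolution (dirichletHamiltonian (r ^ 4) (u ^ 2) Γ) t (X.mul ψ)
      - evolution (dirichletHamiltonian (r ^ 4) (u ^ 2) Γ) t (insideTube (u ^ 2) Γ ψ)‖
      ≤ M * (r / u ^ 5) := by
    rw [← map_sub, hW.norm_apply, norm_sub_rev]
    exact h5 h2
  have h7 := norm_sub_le_norm_sub_add_norm_sub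
    (insideTube (u ^ 2) Γ (evolution (hamiltonian (r ^ 4) Γ) t ψ))
    (X.mul (evolution (hamiltonian (r ^ 4) Γ) t ψ))
    (evolution (dirichletHamiltonian (r ^ 4) (u ^ 2) Γ) t (insideTube (u ^ 2) Γ ψ))
  have h8 := norm_sub_le_norm_sub_add_norm_sub
    (X.mul (evolution (hamiltonian (r ^ 4) Γ) t ψ))
    (evolution (dirichletHamiltonian (r ^ 4) (u ^ 2) Γ) t (X.mul ψ))
    (evolution (dirichletHamiltonian (r ^ 4) (u ^ 2) Γ) t (insideTube (u ^ 2) Γ ψ))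
  have h9 := h5 h1
  linarith

end

end ConstrainedPlane

end

open ConstrainedPlane in
theorem mainTheorem5 :
    -- well-posedness: the unitary groups exist
    (∀ (ϑ : ℝ) (k : ℝ → ℝ) (ε δ : ℝ) (Γ : Set Plane),
      0 < ϑ → ϑ < Real.pi → IsProfile k → 0 < ε → 0 < δ → IsSmoothedGraph ϑ k δ Γ →
      IsUnitaryGroupOf (hamiltonian ε Γ) (evolution (hamiltonian ε Γ)) ∧
      IsUnitaryGroupOf (dirichletHamiltonian ε δ Γ) (evolution (dirichletHamiltonian ε δ Γ))) ∧
    -- localization in the tube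
    (∀ (ϑ : ℝ) (k : ℝ → ℝ) (ε δ : ℝ) (Γ : Set Plane),
      0 < ϑ → ϑ < Real.pi → IsProfile k → 0 < ε → 0 < δ → IsSmoothedGraph ϑ k δ Γ →
      ∀ (C₁ : ℝ) (ψ : (hamiltonian ε Γ).domain),
        ‖(ψ : L2)‖ = 1 → ‖hamiltonian ε Γ ψ‖ ≤ C₁ / ε →
        ∀ t : ℝ, ‖outsideTube δ Γ (evolution (hamiltonian ε Γ) t ψ)‖
          ≤ (2 * C₁) ^ (1 / 2 : ℝ) * (ε ^ (1 / 2 : ℝ) / δ)) ∧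
    -- comparison with the Dirichlet evolution
    (∀ C₁ T : ℝ, ∃ C₂ : ℝ, ∀ (ϑ : ℝ) (k : ℝ → ℝ) (δ : ℝ → ℝ),
      0 < ϑ → ϑ < Real.pi → IsProfile k → (∀ ε, 0 < ε → 0 < δ ε) →
      Tendsto δ (𝓝[>] 0) (𝓝 0) →
      Tendsto (fun ε => ε ^ (1 / 2 : ℝ) / δ ε) (𝓝[>] 0) (𝓝 0) →
      ∀ᶠ ε in 𝓝[>] 0, ∀ Γ : Set Plane, IsSmoothedGraph ϑ k (δ ε) Γ →
        ∀ ψ : (hamiltonian ε Γ).domain,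
          ‖(ψ : L2)‖ = 1 → ‖hamiltonian ε Γ ψ‖ ≤ C₁ / ε →
          ∀ t ∈ Set.Icc 0 T,
            ‖insideTube (δ ε) Γ (evolution (hamiltonian ε Γ) t ψ)
                - evolution (dirichletHamiltonian ε (δ ε) Γ) t (insideTube (δ ε) Γ ψ)‖
              ≤ C₂ * (ε ^ (1 / 4 : ℝ) / δ ε ^ (5 / 2 : ℝ)
                + ε ^ (1 / 2 : ℝ) / δ ε ^ (3 : ℝ))) := by

  refine ⟨fun ϑ k ε δ Γ _ _ _ _ hδ hΓ => ⟨isUnitaryGroupOf_hamiltonian ε Γ,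
    isUnitaryGroupOf_dirichletHamiltonian hΓ.nonempty hδ⟩,
    fun ϑ k ε δ Γ _ _ _ hε hδ _ C ψ hψ hC t =>
      norm_outsideTube_evolution_le hε hδ ψ hψ hC t, fun C T => ?_⟩
  obtain ⟨K, hK, hcut⟩ := exists_tubeCutoff
  -- `K` is a universal cutoff constant, so this value depends on `C` and `T` alone.
  refine ⟨2 * (128 * C + 12 * K) + Real.sqrt (2 * (128 * C + 12 * K) +
        2 * (Real.sqrt (2 * C + K ^ 2) * K * (128 * C + 12 * K
          + 16 * Real.sqrt ((128 * C + 12 * K) * C + K ^ 2)) * T)), ?_⟩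
  intro ϑ k δ _ _ _ hδ hδ0 hδ1
  -- Smallness of `ε` means just `δ < 1` and `ε^(1/2) < δ`.
  filter_upwards [self_mem_nhdsWithin, hδ0.eventually_lt_const one_pos,
    hδ1.eventually_lt_const one_pos] with ε hε hδε hεδ Γ hΓ ψ hψ hC t ht
  have hε : 0 < ε := hε
  have hδε0 := hδ ε hε
  -- A negative `C` admits no `ψ`, so the sign is available once `ψ` is given.
  have hC0 : 0 ≤ C := by
    have := (norm_nonneg _).trans hC
    by_contra! h
    exact absurd this (not_le.2 (div_neg_of_neg_of_pos h hε))
  rw [div_lt_one hδε0] at hεδ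
  generalize δ ε = d at *
  set r := ε ^ (1 / 4 : ℝ) with hr
  have hr0 : 0 < r := Real.rpow_pos_of_pos hε _
  have hr4 : ε = r ^ 4 := by
    rw [hr, ← Real.rpow_natCast, ← Real.rpow_mul hε.le]
    norm_num
  obtain ⟨u, hu0, rfl⟩ : ∃ u, 0 < u ∧ d = u ^ 2 :=
    ⟨Real.sqrt d, Real.sqrt_pos.2 hδε0, (Real.sq_sqrt hδε0.le).symm⟩
  have e2 : ε ^ (1 / 2 : ℝ) = r ^ 2 := by
    rw [hr, ← Real.rpow_natCast, ← Real.rpow_mul hε.le]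
    norm_num
  have e5 : (u ^ 2) ^ (5 / 2 : ℝ) = u ^ 5 := by
    rw [← Real.rpow_natCast u 2, ← Real.rpow_mul hu0.le, ← Real.rpow_natCast]
    norm_num
  rw [e2] at hεδ
  have hru : r ≤ u := (lt_of_pow_lt_pow_left₀ 2 hu0.le hεδ).le
  have hu1 : u ≤ 1 := by
    by_contra! h
    nlinarith
  clear_value r
  subst hr4
  obtain ⟨F, X, h⟩ := hcut Γ (u ^ 2) hδε0
  refine (norm_insideTube_evolution_sub_le hΓ.nonempty hr0 hu0 hru hu1 hK hC0 h hψ hC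
    ((hamiltonian (r ^ 4) Γ).mem_graph ψ) ht.1).trans ?_
  have hT := ht.2
  -- The first summand alone carries the bound; the second is slack.
  have h1 : r / u ^ 5 ≤ r / (u ^ 2) ^ (5 / 2 : ℝ)
      + (r ^ 4) ^ (1 / 2 : ℝ) / (u ^ 2) ^ (3 : ℝ) := by
    rw [e5]
    have : 0 ≤ (r ^ 4) ^ (1 / 2 : ℝ) / (u ^ 2) ^ (3 : ℝ) := by positivity
    linarith
  refine mul_le_mul ?_ h1 (by positivity) (by positivity)
  gcongr
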